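/- Let $Q$ be a finite quiver with vertex set $I$, and write $h(a),t(a)$ for the head and tail of an arrow $a$. Let $\overline Q$ be the double quiver (for each arrow $a$ add an arrow $a^*$ in the opposite direction), let $\mathbb C\overline Q$ be its path algebra (paths written from right to left), and let $\mathbb C\overline Q^r$ be the span of the paths containing exactly $r$ dual arrows. Let $\mathcal V Q=\bigoplus_r\mathcal V^rQ$ be the quotient of the vector space $\mathbb C\overline Q$ by the span of all $PR-(-1)^{pr}RP$ with $P\in\mathbb C\overline Q^p$, $R\in\mathbb C\overline Q^r$. For an arrow $w$ of $\overline Q$ let $D_w:\mathcal VQ\to\mathbb C\overline Q$ be the linear map with $$D_w(x_1\cdots x_n)=\sum_{x_i=w}(-1)^{\nu_i\mu_i}x_{i+1}\cdots x_nx_1\cdots x_{i-1}$$ on closed paths, where $\nu_i$ (resp. $\mu_i$) is the number of dual arrows among $x_{i+1},\dots,x_n$ (resp. $x_1,\dots,x_i$); an empty product is the trivial path at $t(w)$, and $D_w$ is $0$ on paths that are not closed. The (necklace) Schouten bracket on $\mathcal VQ$ is the bilinear map with $$[\gamma,\delta]=\sum_{a\in Q}\bigl(D_{a^*}(\gamma)D_a(\delta)-(-1)^{(r-1)(s-1)}D_{a^*}(\delta)D_a(\gamma)\bigr)\qquad(\gamma\in\mathcal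 V^rQ,\ \delta\in\mathcal V^sQ).$$ Let $\alpha\in\mathbb N^I$, let $M=\mathrm{Rep}(Q,\alpha)=\bigoplus_{a\in Q}\mathrm{Mat}_{\alpha_{h(a)}\times\alpha_{t(a)}}(\mathbb C)$ with coordinates $X=(X_a)$, let $G=\prod_iGL_{\alpha_i}(\mathbb C)$ act on $M$ by $(gX)_a=g_{h(a)}X_ag_{t(a)}^{-1}$, and let $\mathcal V(M)$ be the algebra of polynomial polyvector fields on $M$ with the usual Schouten bracket $$[X_1\cdots X_r,Y_1\cdots Y_s]=\sum_{i,j}(-1)^{i+j}[X_i,Y_j]\,X_1\cdots\widehat{X_i}\cdots X_r\,Y_1\cdots\widehat{Y_j}\cdots Y_s$$ (products of vector fields are wedge products). For $\lambda\in\mathbb C^I$ with $\lambda_{h(a)}=\lambda_{t(a)}$ for every arrow $a$, let $\Psi_\lambda:\mathcal VQ\to\mathcal V(M)$ be the linear map which sends a path $x_1\cdots x_n$ with head $i$ to $0$ if it is not closed, and otherwise to $\lambda_i$ times the trace of the product of matrices obtained by replacing each $a$ by the matrix $X_a$ of coordinate functions and each $a^*$ by the $\alpha_{t(a)}\times\alpha_{h(a)}$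 matrix whose $(n,m)$ entry is the vector field $\partial/\partial (X_a)_{mn}$, the entries being multiplied in the exterior algebra of polyvector fields (this is well defined on $\mathcal VQ$). Let $\Psi=\Psi_{(1,\dots,1)}$. **Theorem.** For every finite quiver $Q$ and every dimension vector $\alpha$: 1. for every such $\lambda$, $\Psi_\lambda$ takes values in $\mathcal V(M)^G$ and maps $\mathcal V^rQ$ into $\mathcal V^r(M)$ for all $r\ge 0$; 2. $\Psi([\gamma,\delta])=[\Psi(\gamma),\Psi(\delta)]$ for all $\gamma,\delta\in\mathcal VQ$; 3. more generally, for every such $\lambda$, $[\Psi_\lambda(\gamma),\Psi_\lambda(\delta)]=\Psi_{\lambda^2}([\gamma,\delta])$ for all $\gamma,\delta\in\mathcal VQ$, where $(\lambda^2)_i=\lambda_i^2$; 4. if $\Pi\in\mathcal V^2Q$ satisfies $[\Pi,\Pi]=0$ (a Poisson structure on $\mathbb CQ$), then for every such $\lambda$ the bivector field $\Psi_\lambda(\Pi)$ is $G$-invariant and satisfies $[\Psi_\lambda(\Pi),\Psi_\lambda(\Pi)]=0$, i.e. it is a $G$-invariant Poisson structure on $\mathrm{Rep}(Q,\alpha)$.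 -/

import Mathlib

open scoped TensorProduct

set_option linter.unusedSectionVars false

noncomputable section

namespace Necklace

/-! ### Paths in the double quiver

A quiver is a Mathlib `Quiver I` on the vertex set `I`; its set of arrows is `Quiver.Total I`.
The tail of an arrow `a` is `a.left` and its head is `a.right`. -/

/-- The arrows of the double quiver: `Sum.inl a` is the arrow `a`,
and `Sum.inr a` is the dual arrow `a*`, which goes in the opposite direction. -/
abbrev DArrow (I : Type*) [Quiver I] : Type _ := Quiver.Total I ⊕ Quiver.Total I

section Paths

variable {I : Type*} [Quiver I]

/-- The head of an arrow of the double quiver. -/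
def dhead : DArrow I → I
  | Sum.inl a => a.right
  | Sum.inr a => a.left

/-- The tail of an arrow of the double quiver. -/
def dtail : DArrow I → I
  | Sum.inl a => a.left
  | Sum.inr a => a.right

/-- `IsPath i w j`: the word `w = x₁ ⋯ xₙ` (paths are written from right to left) is a path of the
double quiver with head `i` and tail `j`. The empty word is the trivial path at `i = j`. -/
def IsPath : I → List (DArrow I) → I → Prop
  | i, [], j => i = j
  | i, x :: w, j => dhead x = i ∧ IsPath (dtail x) w j

theorem isPath_append {i j : I} {u v : List (DArrow I)} :
    IsPath i (u ++ v) j ↔ ∃ m, IsPath i u m ∧ IsPath m v j := by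
  induction u generalizing i with
  | nil => simp [IsPath]
  | cons x u ih => simp [IsPath, ih, and_assoc]

theorem IsPath.tail_unique {i j k : I} {u : List (DArrow I)}
    (h : IsPath i u j) (h' : IsPath i u k) : j = k := by
  induction u generalizing i with
  | nil => exact h.symm.trans h'
  | cons x u ih => exact ih h.2 h'.2

variable (I) in
/-- Paths of the double quiver (including the trivial paths). -/
@[ext]
structure DPath where
  head : I
  tail : I
  word : List (DArrow I)
  isPath : IsPath head word tail

/-- The number of dual arrows in a word. -/
def dualDeg (w : List (DArrow I)) : ℕ := w.countP Sum.isRight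

theorem dualDeg_append (u v : List (DArrow I)) : dualDeg (u ++ v) = dualDeg u + dualDeg v :=
  List.countP_append

/-- The degree of a path: its number of dual arrows. -/
def DPath.deg (p : DPath I) : ℕ := dualDeg p.word

variable (I) in
/-- The (underlying vector space of the) path algebra over `ℂ` of the double quiver:
it has the paths as a basis. The product is `pathMul`. -/
abbrev PathAlg : Type _ := DPath I →₀ ℂ

open Classical in
/-- The element of the path algebra given by a word, if this is a path with head `i` and tail `j`,
and `0` otherwise. -/
def ofWord (i : I) (w : List (DArrow I)) (j : I) : PathAlg I :=
  if h : IsPath i w j then Finsupp.single ⟨i, j, w, h⟩ 1 else 0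

theorem ofWord_of_isPath {i j : I} {w : List (DArrow I)} (h : IsPath i w j) :
    ofWord i w j = Finsupp.single ⟨i, j, w, h⟩ 1 := by
  simp [ofWord, h]

variable (I) in
/-- The homogeneous part `ℂQ̄ʳ` of the path algebra: the span of the paths of degree `r`. -/
def pathGrade (r : ℕ) : Submodule ℂ (PathAlg I) :=
  Submodule.span ℂ {z | ∃ p : DPath I, p.deg = r ∧ z = Finsupp.single p 1}

theorem single_mem_pathGrade (p : DPath I) : Finsupp.single p 1 ∈ pathGrade I p.deg :=
  Submodule.subset_span ⟨p, rfl, rfl⟩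

end Paths

section Algebra

variable {I : Type*} [Quiver I] [DecidableEq I]

/-- The product of two paths: their concatenation if they are composable, and `0` otherwise. -/
def compose (p q : DPath I) : PathAlg I :=
  if p.tail = q.head then ofWord p.head (p.word ++ q.word) q.tail else 0

/-- The product of the path algebra. -/
def pathMul : PathAlg I →ₗ[ℂ] PathAlg I →ₗ[ℂ] PathAlg I :=
  Finsupp.lift (PathAlg I →ₗ[ℂ] PathAlg I) ℂ (DPath I)
    fun p => Finsupp.lift (PathAlg I) ℂ (DPath I) fun q => compose p q

@[simp]
theorem pathMul_single (p q : DPath I) :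
    pathMul (Finsupp.single p 1) (Finsupp.single q 1) = compose p q := by
  simp [pathMul]

theorem compose_of_isPath {p q : DPath I} (h : p.tail = q.head) :
    ∃ hw, compose p q = Finsupp.single ⟨p.head, q.tail, p.word ++ q.word, hw⟩ 1 := by
  have hw : IsPath p.head (p.word ++ q.word) q.tail :=
    isPath_append.2 ⟨p.tail, p.isPath, by rw [h]; exact q.isPath⟩
  exact ⟨hw, by rw [compose, if_pos h, ofWord_of_isPath hw]⟩

theorem compose_mem_pathGrade (p q : DPath I) : compose p q ∈ pathGrade I (p.deg + q.deg) := by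
  by_cases h : p.tail = q.head
  · obtain ⟨hw, e⟩ := compose_of_isPath h
    rw [e]
    exact Submodule.subset_span ⟨⟨_, _, _, hw⟩, dualDeg_append p.word q.word, rfl⟩
  · rw [compose, if_neg h]
    exact zero_mem _

theorem superCommutator_mem_pathGrade (p q : DPath I) :
    compose p q - (-1 : ℂ) ^ (p.deg * q.deg) • compose q p ∈ pathGrade I (p.deg + q.deg) :=
  sub_mem (compose_mem_pathGrade p q)
    (Submodule.smul_mem _ _ (add_comm p.deg q.deg ▸ compose_mem_pathGrade q p))

/-! ### The graded necklace space and its bracket -/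

variable (I) in
/-- The span of all `P R - (-1)^{pq} R P` with `P` of degree `p` and `R` of degree `q`. -/
def superCommutators : Submodule ℂ (PathAlg I) :=
  Submodule.span ℂ {z | ∃ (p q : ℕ) (P R : PathAlg I), P ∈ pathGrade I p ∧ R ∈ pathGrade I q ∧
    z = pathMul P R - (-1 : ℂ) ^ (p * q) • pathMul R P}

theorem superCommutators_le {S : Submodule ℂ (PathAlg I)}
    (h : ∀ p q : DPath I, compose p q - (-1 : ℂ) ^ (p.deg * q.deg) • compose q p ∈ S) :
    superCommutators I ≤ S := by
  refine Submodule.span_le.2 ?_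
  rintro _ ⟨m, n, P, R, hP, hR, rfl⟩
  change _ ∈ S
  induction hP using Submodule.span_induction with
  | zero => simp
  | add a b _ _ ha hb =>
    have := add_mem ha hb
    simp only [map_add, LinearMap.add_apply, smul_add]
    convert this using 1
    abel
  | smul c a _ ha =>
    have := S.smul_mem c ha
    rw [smul_sub, smul_comm c] at this
    simpa using this
  | mem a ha =>
    obtain ⟨p, rfl, rfl⟩ := ha
    induction hR using Submodule.span_induction with
    | zero => simp
    | add a b _ _ ha hb =>
      have := add_mem ha hb
      simp only [map_add, LinearMap.add_apply, smul_add]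
      convert this using 1
      abel
    | smul c a _ ha =>
      have := S.smul_mem c ha
      rw [smul_sub, smul_comm c] at this
      simpa using this
    | mem a ha =>
      obtain ⟨q, rfl, rfl⟩ := ha
      simpa using h p q

variable (I) in
/-- The space `𝒱Q`: the quotient of the path algebra of the double quiver by the relations
`P R = (-1)^{pq} R P`. -/
abbrev NecklaceSpace : Type _ := PathAlg I ⧸ superCommutators I

/-- The class in `𝒱Q` of an element of the path algebra. -/
def toNecklace : PathAlg I →ₗ[ℂ] NecklaceSpace I := (superCommutators I).mkQ

variable (I) in
/-- The homogeneous part `𝒱ʳQ`. -/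
def necklaceGrade (r : ℕ) : Submodule ℂ (NecklaceSpace I) := (pathGrade I r).map toNecklace

end Algebra

section Bracket

variable {I : Type*} [Quiver I] [DecidableEq (Quiver.Total I)]

/-- The sum, over all positions of the letter `x` in the word `x₁ ⋯ xₙ`, of the signed words
`xᵢ₊₁ ⋯ xₙ x₁ ⋯ xᵢ₋₁`. -/
def cutSum (x : DArrow I) (w : List (DArrow I)) : PathAlg I :=
  ∑ k ∈ Finset.range w.length,
    if w[k]? = some x then
      (-1 : ℂ) ^ (dualDeg (w.drop (k + 1)) * dualDeg (w.take (k + 1))) •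
        ofWord (dtail x) (w.drop (k + 1) ++ w.take k) (dhead x)
    else 0

theorem cutSum_rotate (x : DArrow I) (u v : List (DArrow I)) :
    cutSum x (u ++ v) = (-1 : ℂ) ^ (dualDeg u * dualDeg v) • cutSum x (v ++ u) := by
  have key : ∀ u v : List (DArrow I), ∀ k < u.length,
      (if (u ++ v)[k]? = some x then
        (-1 : ℂ) ^ (dualDeg ((u ++ v).drop (k + 1)) * dualDeg ((u ++ v).take (k + 1))) •
          ofWord (dtail x) ((u ++ v).drop (k + 1) ++ (u ++ v).take k) (dhead x) else 0) =
      (-1 : ℂ) ^ (dualDeg u * dualDeg v) •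
      (if (v ++ u)[v.length + k]? = some x then
        (-1 : ℂ) ^ (dualDeg ((v ++ u).drop (v.length + k + 1)) *
            dualDeg ((v ++ u).take (v.length + k + 1))) •
          ofWord (dtail x) ((v ++ u).drop (v.length + k + 1) ++ (v ++ u).take (v.length + k))
            (dhead x) else 0) := by
    intro u v k hk
    have hu : dualDeg u = dualDeg (u.take (k + 1)) + dualDeg (u.drop (k + 1)) := by
      rw [← dualDeg_append, List.take_append_drop]
    have e1 : (u ++ v)[k]? = (v ++ u)[v.length + k]? := by
      rw [List.getElem?_append_left hk, List.getElem?_append_right (by omega)]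
      simp
    rw [e1]
    split_ifs with h
    · rw [List.drop_append_of_le_length (by omega), List.take_append_of_le_length (by omega),
        List.take_append_of_le_length (by omega), add_assoc, List.drop_length_add_append,
        List.take_length_add_append, List.take_length_add_append, smul_smul, ← pow_add,
        dualDeg_append, dualDeg_append, hu, List.append_assoc]
      congr 1
      rw [neg_one_pow_eq_pow_mod_two, neg_one_pow_eq_pow_mod_two (n := _ + _)]
      congr 1
      ring_nf
      omega
    · simp
  unfold cutSum
  have hs : ∀ k : ℕ, (-1 : ℂ) ^ k * (-1 : ℂ) ^ k = 1 := fun k => by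
    rw [← mul_pow]; simp
  rw [List.length_append, Finset.sum_range_add, List.length_append, Finset.sum_range_add,
    smul_add, add_comm]
  congr 1
  · rw [Finset.smul_sum]
    refine Finset.sum_congr rfl fun k hk => ?_
    rw [key v u k (Finset.mem_range.1 hk), smul_smul, mul_comm (dualDeg v), hs, one_smul]
  · rw [Finset.smul_sum]
    exact Finset.sum_congr rfl fun k hk => key u v k (Finset.mem_range.1 hk)

variable [DecidableEq I]

/-- The directional superderivative of a path: `cutSum` on closed paths, and `0` on paths that are
not closed (they vanish in `𝒱Q`). -/
def pathD (x : DArrow I) (p : DPath I) : PathAlg I :=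
  if p.head = p.tail then cutSum x p.word else 0

/-- The linear extension of `pathD` to the path algebra. -/
def algD (x : DArrow I) : PathAlg I →ₗ[ℂ] PathAlg I :=
  Finsupp.lift (PathAlg I) ℂ (DPath I) fun p => pathD x p

@[simp]
theorem algD_single (x : DArrow I) (p : DPath I) : algD x (Finsupp.single p 1) = pathD x p := by
  simp [algD]

theorem algD_compose (x : DArrow I) (p q : DPath I) :
    algD x (compose p q) = (-1 : ℂ) ^ (p.deg * q.deg) • algD x (compose q p) := by
  by_cases h : p.tail = q.head <;> by_cases h' : q.tail = p.head
  · obtain ⟨hw, e⟩ := compose_of_isPath h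
    obtain ⟨hw', e'⟩ := compose_of_isPath h'
    rw [e, e', algD_single, algD_single, pathD, pathD, if_pos h'.symm, if_pos h.symm]
    exact cutSum_rotate x _ _
  · obtain ⟨hw, e⟩ := compose_of_isPath h
    rw [e, compose, if_neg h', algD_single, pathD, if_neg (Ne.symm h')]
    simp
  · obtain ⟨hw, e⟩ := compose_of_isPath h'
    rw [e, compose, if_neg h, algD_single, pathD, if_neg (Ne.symm h)]
    simp
  · simp [compose, h, h']

theorem superCommutators_le_ker_algD (x : DArrow I) :
    superCommutators I ≤ LinearMap.ker (algD x) :=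
  superCommutators_le fun p q => by
    rw [LinearMap.mem_ker, map_sub, map_smul, algD_compose, sub_self]

/-- The directional superderivative `D_x : 𝒱Q → ℂQ̄`. -/
def superD (x : DArrow I) : NecklaceSpace I →ₗ[ℂ] PathAlg I :=
  (superCommutators I).liftQ (algD x) (superCommutators_le_ker_algD x)

variable [Fintype (Quiver.Total I)]

/-- The bracket of (the necklaces of) two paths. Here `(deg p + 1) (deg q + 1)` has the parity
of `(deg p - 1) (deg q - 1)`. -/
def pathBracket (p q : DPath I) : NecklaceSpace I :=
  ∑ a : Quiver.Total I,
    (toNecklace (pathMul (pathD (Sum.inr a) p) (pathD (Sum.inl a) q)) -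
      (-1 : ℂ) ^ ((p.deg + 1) * (q.deg + 1)) •
        toNecklace (pathMul (pathD (Sum.inr a) q) (pathD (Sum.inl a) p)))

/-- The bilinear extension of `pathBracket`. -/
def algBracket : PathAlg I →ₗ[ℂ] PathAlg I →ₗ[ℂ] NecklaceSpace I :=
  Finsupp.lift (PathAlg I →ₗ[ℂ] NecklaceSpace I) ℂ (DPath I)
    fun p => Finsupp.lift (NecklaceSpace I) ℂ (DPath I) fun q => pathBracket p q

theorem algBracket_homogeneous {r s : ℕ} {P R : PathAlg I}
    (hP : P ∈ pathGrade I r) (hR : R ∈ pathGrade I s) :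
    algBracket P R = ∑ a : Quiver.Total I,
      (toNecklace (pathMul (algD (Sum.inr a) P) (algD (Sum.inl a) R)) -
        (-1 : ℂ) ^ ((r + 1) * (s + 1)) •
          toNecklace (pathMul (algD (Sum.inr a) R) (algD (Sum.inl a) P))) := by
  induction hP using Submodule.span_induction with
  | zero => simp
  | add a b _ _ ha hb =>
    simp only [map_add, LinearMap.add_apply, smul_add, ha, hb, ← Finset.sum_add_distrib]
    exact Finset.sum_congr rfl fun _ _ => by abel
  | smul c a _ ha =>
    simp only [map_smul, LinearMap.smul_apply, ha, Finset.smul_sum, smul_sub]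
    exact Finset.sum_congr rfl fun _ _ => by rw [smul_comm c]
  | mem a ha =>
    obtain ⟨p, rfl, rfl⟩ := ha
    induction hR using Submodule.span_induction with
    | zero => simp
    | add a b _ _ ha hb =>
      simp only [map_add, LinearMap.add_apply, smul_add, ha, hb, ← Finset.sum_add_distrib]
      exact Finset.sum_congr rfl fun _ _ => by abel
    | smul c a _ ha =>
      simp only [map_smul, LinearMap.smul_apply, ha, Finset.smul_sum, smul_sub]
      exact Finset.sum_congr rfl fun _ _ => by rw [smul_comm c]
    | mem a ha =>
      obtain ⟨q, rfl, rfl⟩ := ha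
      simp [algBracket, pathBracket]

theorem superCommutators_le_ker_algBracket_flip :
    superCommutators I ≤ LinearMap.ker (algBracket (I := I)).flip :=
  superCommutators_le fun p q => by
    refine LinearMap.mem_ker.2 (Finsupp.lhom_ext' fun p' => LinearMap.ext_ring ?_)
    have h := fun x => LinearMap.mem_ker.1 (superCommutators_le_ker_algD x
      (Submodule.subset_span ⟨_, _, _, _, single_mem_pathGrade p, single_mem_pathGrade q, rfl⟩))
    simp only [pathMul_single] at h
    simp [algBracket_homogeneous (single_mem_pathGrade p') (superCommutator_mem_pathGrade p q), h,
      -map_sub]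

theorem superCommutators_le_ker_algBracket :
    superCommutators I ≤ LinearMap.ker (((superCommutators I).liftQ (algBracket (I := I)).flip
      superCommutators_le_ker_algBracket_flip).flip) :=
  superCommutators_le fun p q => by
    refine LinearMap.mem_ker.2 (Submodule.linearMap_qext _ ?_)
    refine Finsupp.lhom_ext' fun p' => LinearMap.ext_ring ?_
    have h := fun x => LinearMap.mem_ker.1 (superCommutators_le_ker_algD x
      (Submodule.subset_span ⟨_, _, _, _, single_mem_pathGrade p, single_mem_pathGrade q, rfl⟩))
    simp only [pathMul_single] at h
    simp [algBracket_homogeneous (superCommutator_mem_pathGrade p q) (single_mem_pathGrade p'), h,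
      -map_sub]

/-- The Schouten bracket of `𝒱Q`: the bilinear map given by the formula of
`necklaceBracket_homogeneous` on homogeneous elements. -/
def necklaceBracket : NecklaceSpace I →ₗ[ℂ] NecklaceSpace I →ₗ[ℂ] NecklaceSpace I :=
  (superCommutators I).liftQ (((superCommutators I).liftQ (algBracket (I := I)).flip
    superCommutators_le_ker_algBracket_flip).flip) superCommutators_le_ker_algBracket

theorem necklaceBracket_homogeneous {r s : ℕ} {γ δ : NecklaceSpace I}
    (hγ : γ ∈ necklaceGrade I r) (hδ : δ ∈ necklaceGrade I s) :
    necklaceBracket γ δ = ∑ a : Quiver.Total I,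
      (toNecklace (pathMul (superD (Sum.inr a) γ) (superD (Sum.inl a) δ)) -
        (-1 : ℂ) ^ (((r : ℤ) - 1) * ((s : ℤ) - 1)) •
          toNecklace (pathMul (superD (Sum.inr a) δ) (superD (Sum.inl a) γ))) := by
  obtain ⟨P, hP, rfl⟩ := hγ
  obtain ⟨R, hR, rfl⟩ := hδ
  have e : (-1 : ℂ) ^ (((r : ℤ) - 1) * ((s : ℤ) - 1)) = (-1 : ℂ) ^ ((r + 1) * (s + 1)) := by
    have : ((r : ℤ) - 1) * ((s : ℤ) - 1) = (((r + 1) * (s + 1) : ℕ) : ℤ) + 2 * (-(r + s : ℤ)) := by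
      push_cast; ring
    rw [this, zpow_add₀ (by simp), zpow_natCast, zpow_mul]
    simp
  rw [e]
  exact algBracket_homogeneous hP hR

/-- A Poisson structure on `ℂQ`: an element `Π` of `𝒱²Q` such that `[Π, Π] = 0`. -/
def IsNecklacePoisson (Pi : NecklaceSpace I) : Prop :=
  Pi ∈ necklaceGrade I 2 ∧ necklaceBracket Pi Pi = 0

end Bracket

/-! ### Polynomial tensor and polyvector fields on an affine space -/

section Polyvector

variable (ι : Type*)

/-- The polynomial functions on `ℂ^ι`. -/
def PolyFun : Type _ := MvPolynomial ι ℂ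

instance : CommRing (PolyFun ι) := inferInstanceAs (CommRing (MvPolynomial ι ℂ))

instance : Algebra ℂ (PolyFun ι) := inferInstanceAs (Algebra ℂ (MvPolynomial ι ℂ))

variable {ι} in
/-- The coordinate functions. -/
def coordFun (c : ι) : PolyFun ι := (MvPolynomial.X c : MvPolynomial ι ℂ)

variable {ι} in
/-- The partial derivative of functions with respect to a coordinate. -/
def partialDeriv (c : ι) : Derivation ℂ (PolyFun ι) (PolyFun ι) :=
  (MvPolynomial.pderiv c : Derivation ℂ (MvPolynomial ι ℂ) (MvPolynomial ι ℂ))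

variable {ι} in
/-- The value of functions at a point. -/
def evalFun (X : ι → ℂ) : PolyFun ι →ₐ[ℂ] ℂ :=
  (MvPolynomial.aeval X : MvPolynomial ι ℂ →ₐ[ℂ] ℂ)

/-- The polynomial contravariant tensor fields on `M = ℂ^ι`: polynomial functions with values in the
tensor algebra of `ℂ^ι` (each tangent space of `M` is `ℂ^ι`). -/
abbrev TensorField : Type _ := PolyFun ι ⊗[ℂ] TensorAlgebra ℂ (ι → ℂ)

/-- The polynomial polyvector fields on `M = ℂ^ι`: polynomial functions with values in the exterior
algebra of `ℂ^ι`. The product is the wedge product. -/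
abbrev PolyVector : Type _ := PolyFun ι ⊗[ℂ] ExteriorAlgebra ℂ (ι → ℂ)

/-- The polynomial polyvector fields `𝒱ʳ(M)` of degree `r`. -/
def polyGrade (r : ℕ) : Submodule ℂ (PolyVector ι) :=
  LinearMap.range (LinearMap.lTensor (PolyFun ι) (⋀[ℂ]^r (ι → ℂ)).subtype)

/-- Restriction of contravariant tensors, viewed as multilinear functions of covectors, to
skew-symmetric covariant tensors: `v₁ ⊗ ⋯ ⊗ vᵣ` becomes `v₁ ∧ ⋯ ∧ vᵣ`, whose value on
`ξ₁ ∧ ⋯ ∧ ξᵣ = ∑_σ sign(σ) ξ_σ(1) ⊗ ⋯ ⊗ ξ_σ(r)` is `det (ξᵢ(vⱼ))`. -/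
def skew : TensorField ι →ₐ[ℂ] PolyVector ι :=
  Algebra.TensorProduct.map (AlgHom.id ℂ (PolyFun ι)) TensorAlgebra.toExterior

variable {ι}

theorem tmul_mem_polyGrade {r : ℕ} (f : PolyFun ι) {y : ExteriorAlgebra ℂ (ι → ℂ)}
    (hy : y ∈ ⋀[ℂ]^r (ι → ℂ)) : f ⊗ₜ[ℂ] y ∈ polyGrade ι r :=
  ⟨f ⊗ₜ[ℂ] ⟨y, hy⟩, rfl⟩

theorem one_mem_polyGrade : (1 : PolyVector ι) ∈ polyGrade ι 0 :=
  tmul_mem_polyGrade 1 SetLike.GradedOne.one_mem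

theorem polyGrade_induction {r : ℕ} {S : Submodule ℂ (PolyVector ι)}
    (h : ∀ (f : PolyFun ι), ∀ y ∈ ⋀[ℂ]^r (ι → ℂ), f ⊗ₜ[ℂ] y ∈ S) : polyGrade ι r ≤ S := by
  rintro _ ⟨z, rfl⟩
  induction z using TensorProduct.induction_on with
  | zero => simp
  | add z z' hz hz' => rw [map_add]; exact add_mem hz hz'
  | tmul f y => exact h f y y.2

theorem exteriorPower_mul_comm {r s : ℕ} {x y : ExteriorAlgebra ℂ (ι → ℂ)}
    (hx : x ∈ ⋀[ℂ]^r (ι → ℂ)) (hy : y ∈ ⋀[ℂ]^s (ι → ℂ)) :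
    x * y = (-1 : ℂ) ^ (r * s) • (y * x) := by
  have h1 : ∀ (v : ι → ℂ) (s : ℕ) (y : ExteriorAlgebra ℂ (ι → ℂ)), y ∈ ⋀[ℂ]^s (ι → ℂ) →
      ExteriorAlgebra.ι ℂ v * y = (-1 : ℂ) ^ s • (y * ExteriorAlgebra.ι ℂ v) := by
    intro v s y hy
    induction hy using Submodule.pow_induction_on_left' with
    | algebraMap t => rw [pow_zero, one_smul, Algebra.commutes]
    | add x y i hx hy h h' => rw [mul_add, h, h', add_mul, smul_add]
    | mem_mul m hm i x hx h =>
      obtain ⟨w, rfl⟩ := hm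
      rw [← mul_assoc, eq_neg_of_add_eq_zero_left (ExteriorAlgebra.ι_add_mul_swap v w), neg_mul,
        mul_assoc, h, mul_smul_comm, pow_succ, mul_neg_one, neg_smul, mul_assoc]
  induction hx using Submodule.pow_induction_on_left' with
  | algebraMap t => rw [Algebra.commutes]; simp
  | add x y i hx hy h h' => rw [add_mul, h, h', mul_add, smul_add]
  | mem_mul m hm i x hx h =>
    obtain ⟨w, rfl⟩ := hm
    rw [mul_assoc, h, mul_smul_comm, ← mul_assoc, h1 w s y hy, smul_mul_assoc, smul_smul,
      ← pow_add, mul_assoc, Nat.succ_mul]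

theorem mul_mem_polyGrade {r s : ℕ} {P R : PolyVector ι} (hP : P ∈ polyGrade ι r)
    (hR : R ∈ polyGrade ι s) : P * R ∈ polyGrade ι (r + s) := by
  refine polyGrade_induction (S := (polyGrade ι (r + s)).comap
    ((LinearMap.mul ℂ (PolyVector ι)).flip R)) (fun f x hx => ?_) hP
  refine polyGrade_induction (S := (polyGrade ι (r + s)).comap
    (LinearMap.mul ℂ (PolyVector ι) (f ⊗ₜ[ℂ] x))) (fun g y hy => ?_) hR
  change (f ⊗ₜ[ℂ] x) * (g ⊗ₜ[ℂ] y) ∈ polyGrade ι (r + s)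
  rw [Algebra.TensorProduct.tmul_mul_tmul]
  exact tmul_mem_polyGrade _ (SetLike.mul_mem_graded hx hy)

theorem mul_comm_polyGrade {r s : ℕ} {P R : PolyVector ι} (hP : P ∈ polyGrade ι r)
    (hR : R ∈ polyGrade ι s) : P * R = (-1 : ℂ) ^ (r * s) • (R * P) := by
  refine polyGrade_induction (S := LinearMap.eqLocus ((LinearMap.mul ℂ (PolyVector ι)).flip R)
    ((-1 : ℂ) ^ (r * s) • LinearMap.mul ℂ (PolyVector ι) R)) (fun f x hx => ?_) hP
  refine polyGrade_induction (S := LinearMap.eqLocus (LinearMap.mul ℂ (PolyVector ι) (f ⊗ₜ[ℂ] x))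
    ((-1 : ℂ) ^ (r * s) • (LinearMap.mul ℂ (PolyVector ι)).flip (f ⊗ₜ[ℂ] x)))
    (fun g y hy => ?_) hR
  change (f ⊗ₜ[ℂ] x) * (g ⊗ₜ[ℂ] y) = (-1 : ℂ) ^ (r * s) • ((g ⊗ₜ[ℂ] y) * (f ⊗ₜ[ℂ] x))
  rw [Algebra.TensorProduct.tmul_mul_tmul, Algebra.TensorProduct.tmul_mul_tmul,
    exteriorPower_mul_comm hx hy, TensorProduct.tmul_smul, mul_comm f]

/-- The value of a polyvector field at a point `X`. -/
def evalAt (X : ι → ℂ) : PolyVector ι →ₗ[ℂ] ExteriorAlgebra ℂ (ι → ℂ) :=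
  (TensorProduct.lid ℂ (ExteriorAlgebra ℂ (ι → ℂ))).toLinearMap ∘ₗ
    LinearMap.rTensor (ExteriorAlgebra ℂ (ι → ℂ)) (evalFun X).toLinearMap

/-- The derivative of (the coefficients of) a polyvector field along a coordinate. -/
def coeffDeriv (c : ι) : PolyVector ι →ₗ[ℂ] PolyVector ι :=
  LinearMap.rTensor (ExteriorAlgebra ℂ (ι → ℂ)) (partialDeriv c).toLinearMap

/-- Left contraction of a polyvector field with the differential of a coordinate function. -/
def contractL (c : ι) : PolyVector ι →ₗ[ℂ] PolyVector ι :=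
  LinearMap.lTensor (PolyFun ι) (CliffordAlgebra.contractLeft (LinearMap.proj c))

/-- Right contraction of a polyvector field with the differential of a coordinate function. -/
def contractR (c : ι) : PolyVector ι →ₗ[ℂ] PolyVector ι :=
  LinearMap.lTensor (PolyFun ι) (CliffordAlgebra.contractRight.flip (LinearMap.proj c))

variable [Fintype ι]

/-- The Schouten bracket of polyvector fields, in coordinates. By `schouten_wedge`,
`schouten_function_wedge` and `schouten_wedge_function` it is the usual one. -/
def schouten : PolyVector ι →ₗ[ℂ] PolyVector ι →ₗ[ℂ] PolyVector ι :=
  ∑ c : ι,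
    ((LinearMap.mul ℂ (PolyVector ι)).compl₁₂ (contractR c) (coeffDeriv c) -
      (LinearMap.mul ℂ (PolyVector ι)).compl₁₂ (coeffDeriv c) (contractL c))

/-- A polynomial Poisson structure on `ℂ^ι`: a bivector field `P` with `[P, P] = 0`. -/
def IsPoisson (P : PolyVector ι) : Prop :=
  P ∈ polyGrade ι 2 ∧ schouten P P = 0

theorem schouten_apply (P R : PolyVector ι) :
    schouten P R = ∑ c, (contractR c P * coeffDeriv c R - coeffDeriv c P * contractL c R) := by
  simp only [schouten, LinearMap.sum_apply, LinearMap.sub_apply, LinearMap.compl₁₂_apply,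
    LinearMap.mul_apply']

variable [DecidableEq ι]

/-- The vector field `∑ f_c ∂/∂c` with coefficients `f`. -/
def vectorField (f : ι → PolyFun ι) : PolyVector ι :=
  ∑ c, f c ⊗ₜ[ℂ] ExteriorAlgebra.ι ℂ (Pi.single c 1)

/-- The derivative `X_f(u)` of a function `u` along the vector field with coefficients `f`. -/
def fieldDeriv (f : ι → PolyFun ι) (u : PolyFun ι) : PolyFun ι :=
  ∑ c, f c * partialDeriv c u

/-- The coefficients of the Lie bracket of the vector fields with coefficients `f` and `g`. -/
def fieldBracket (f g : ι → PolyFun ι) : ι → PolyFun ι :=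
  fun c => fieldDeriv f (g c) - fieldDeriv g (f c)

/-- The wedge product of a list of vector fields. -/
def wedge {r : ℕ} (X : Fin r → ι → PolyFun ι) : PolyVector ι :=
  (List.ofFn fun i => vectorField (X i)).prod

theorem coeffDeriv_mul (c : ι) (P R : PolyVector ι) :
    coeffDeriv c (P * R) = coeffDeriv c P * R + P * coeffDeriv c R := by
  induction P using TensorProduct.induction_on with
  | zero => simp
  | add P P' hP hP' =>
    rw [add_mul, map_add, hP, hP', map_add, add_mul, add_mul]; abel
  | tmul f y =>
    induction R using TensorProduct.induction_on with
    | zero => simp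
    | add R R' hR hR' =>
      rw [mul_add, map_add, hR, hR', map_add, mul_add, mul_add]; abel
    | tmul g z =>
      simp only [coeffDeriv, LinearMap.rTensor_tmul, Algebra.TensorProduct.tmul_mul_tmul,
        Derivation.coeFn_coe, Derivation.leibniz, smul_eq_mul,
        ← TensorProduct.add_tmul]
      rw [add_comm, mul_comm g]

theorem coeffDeriv_vectorField (c : ι) (f : ι → PolyFun ι) :
    coeffDeriv c (vectorField f) = vectorField fun d => partialDeriv c (f d) := by
  simp [vectorField, coeffDeriv]

theorem contractL_vectorField_mul (c : ι) (f : ι → PolyFun ι) (P : PolyVector ι) :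
    contractL c (vectorField f * P) =
      (f c ⊗ₜ[ℂ] 1) * P - vectorField f * contractL c P := by
  have key : ∀ (d : ι) (P : PolyVector ι),
      contractL c ((f d ⊗ₜ[ℂ] ExteriorAlgebra.ι ℂ (Pi.single d 1)) * P) =
        (if d = c then (f d ⊗ₜ[ℂ] 1) * P else 0) -
          (f d ⊗ₜ[ℂ] ExteriorAlgebra.ι ℂ (Pi.single d 1)) * contractL c P := by
    intro d P
    induction P using TensorProduct.induction_on with
    | zero => simp
    | add R R' hR hR' =>
      rw [mul_add, map_add, hR, hR', map_add, mul_add, mul_add]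
      split_ifs <;> abel
    | tmul g z =>
      have h := CliffordAlgebra.contractLeft_ι_mul (Q := (0 : QuadraticForm ℂ (ι → ℂ)))
        (LinearMap.proj c) (Pi.single d 1) z
      simp only [contractL, LinearMap.lTensor_tmul, Algebra.TensorProduct.tmul_mul_tmul]
      erw [h]
      rw [TensorProduct.tmul_sub]
      congr 1
      by_cases hd : d = c
      · subst hd; simp
      · simp [hd, Ne.symm hd]
  rw [vectorField, Finset.sum_mul, map_sum, Finset.sum_congr rfl fun d _ => key d P,
    Finset.sum_sub_distrib, Finset.sum_mul]
  simp

theorem contractR_mul_vectorField (c : ι) (f : ι → PolyFun ι) (P : PolyVector ι) :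
    contractR c (P * vectorField f) =
      (f c ⊗ₜ[ℂ] 1) * P - contractR c P * vectorField f := by
  have key : ∀ (d : ι) (P : PolyVector ι),
      contractR c (P * (f d ⊗ₜ[ℂ] ExteriorAlgebra.ι ℂ (Pi.single d 1))) =
        (if d = c then (f d ⊗ₜ[ℂ] 1) * P else 0) -
          contractR c P * (f d ⊗ₜ[ℂ] ExteriorAlgebra.ι ℂ (Pi.single d 1)) := by
    intro d P
    induction P using TensorProduct.induction_on with
    | zero => simp
    | add R R' hR hR' =>
      rw [add_mul, map_add, hR, hR', map_add, mul_add, add_mul]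
      split_ifs <;> abel
    | tmul g z =>
      have h := CliffordAlgebra.contractRight_mul_ι (Q := (0 : QuadraticForm ℂ (ι → ℂ)))
        (LinearMap.proj c) (Pi.single d 1) z
      simp only [contractR, LinearMap.lTensor_tmul, Algebra.TensorProduct.tmul_mul_tmul,
        LinearMap.flip_apply]
      erw [h]
      rw [TensorProduct.tmul_sub]
      congr 1
      by_cases hd : d = c
      · subst hd; simp [mul_comm g]
      · simp [hd, Ne.symm hd]
  rw [vectorField, Finset.mul_sum, map_sum, Finset.sum_congr rfl fun d _ => key d P,
    Finset.sum_sub_distrib, Finset.mul_sum]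
  simp

theorem function_mul_comm (u : PolyFun ι) (P : PolyVector ι) :
    (u ⊗ₜ[ℂ] 1) * P = P * (u ⊗ₜ[ℂ] 1) := by
  induction P using TensorProduct.induction_on with
  | zero => simp
  | add R R' hR hR' => rw [mul_add, add_mul, hR, hR']
  | tmul g z => simp [mul_comm u]

theorem vectorField_mul_vectorField (f g : ι → PolyFun ι) :
    vectorField f * vectorField g = -(vectorField g * vectorField f) := by
  rw [vectorField, vectorField, Finset.sum_mul_sum, Finset.sum_mul_sum, Finset.sum_comm,
    ← Finset.sum_neg_distrib]
  refine Finset.sum_congr rfl fun c _ => ?_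
  rw [← Finset.sum_neg_distrib]
  refine Finset.sum_congr rfl fun d _ => ?_
  rw [Algebra.TensorProduct.tmul_mul_tmul, Algebra.TensorProduct.tmul_mul_tmul, mul_comm (f d),
    eq_neg_of_add_eq_zero_left (ExteriorAlgebra.ι_add_mul_swap (R := ℂ) (M := ι → ℂ) _ _),
    TensorProduct.tmul_neg]

theorem wedge_zero (X : Fin 0 → ι → PolyFun ι) : wedge X = 1 := by simp [wedge]

theorem wedge_succ {r : ℕ} (X : Fin (r + 1) → ι → PolyFun ι) :
    wedge X = vectorField (X 0) * wedge fun k => X k.succ := by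
  simp [wedge, List.ofFn_succ]

theorem wedge_succ_last {r : ℕ} (X : Fin (r + 1) → ι → PolyFun ι) :
    wedge X = (wedge fun k => X k.castSucc) * vectorField (X (Fin.last r)) := by
  rw [wedge, List.ofFn_succ', List.concat_eq_append, List.prod_append, List.prod_singleton, wedge]

theorem wedge_mul_vectorField {r : ℕ} (X : Fin r → ι → PolyFun ι) (f : ι → PolyFun ι) :
    wedge X * vectorField f = (-1 : ℂ) ^ r • (vectorField f * wedge X) := by
  induction r with
  | zero => simp [wedge_zero]
  | succ r ih =>
    rw [wedge_succ, mul_assoc, ih, mul_smul_comm, ← mul_assoc, vectorField_mul_vectorField,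
      neg_mul, mul_assoc, pow_succ, mul_neg_one, neg_smul, smul_neg]

theorem coeffDeriv_one (c : ι) : coeffDeriv c (1 : PolyVector ι) = 0 := by
  simp [coeffDeriv, Algebra.TensorProduct.one_def]

theorem contractL_one (c : ι) : contractL c (1 : PolyVector ι) = 0 := by
  simp [contractL, Algebra.TensorProduct.one_def]

theorem contractR_one (c : ι) : contractR c (1 : PolyVector ι) = 0 := by
  simp [contractR, Algebra.TensorProduct.one_def]

theorem coeffDeriv_wedge (c : ι) {s : ℕ} (Y : Fin (s + 1) → ι → PolyFun ι) :
    coeffDeriv c (wedge Y) = ∑ j : Fin (s + 1), (-1 : ℂ) ^ (j : ℕ) •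
      ((vectorField fun d => partialDeriv c (Y j d)) *
        wedge fun k => Y (j.succAbove k)) := by
  induction s with
  | zero =>
    rw [wedge_succ, wedge_zero, mul_one, coeffDeriv_vectorField]
    simp [wedge_zero]
  | succ s ih =>
    rw [wedge_succ, coeffDeriv_mul, coeffDeriv_vectorField, ih,
      Fin.sum_univ_succ (n := s + 1), Finset.mul_sum]
    congr 1
    · simp
    · refine Finset.sum_congr rfl fun j _ => ?_
      rw [wedge_succ fun k => Y (j.succ.succAbove k), mul_smul_comm, ← mul_assoc,
        vectorField_mul_vectorField, neg_mul, mul_assoc, Fin.val_succ, pow_succ, mul_neg_one,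
        neg_smul, smul_neg]
      simp

theorem contractL_wedge (c : ι) {s : ℕ} (Y : Fin (s + 1) → ι → PolyFun ι) :
    contractL c (wedge Y) = ∑ j : Fin (s + 1), (-1 : ℂ) ^ (j : ℕ) •
      ((Y j c ⊗ₜ[ℂ] 1) * wedge fun k => Y (j.succAbove k)) := by
  induction s with
  | zero =>
    rw [wedge_succ, contractL_vectorField_mul, wedge_zero, contractL_one]
    simp [wedge_zero]
  | succ s ih =>
    rw [wedge_succ, contractL_vectorField_mul, ih, Fin.sum_univ_succ (n := s + 1), Finset.mul_sum,
      sub_eq_add_neg, ← Finset.sum_neg_distrib]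
    congr 1
    · simp
    · refine Finset.sum_congr rfl fun j _ => ?_
      rw [wedge_succ fun k => Y (j.succ.succAbove k), mul_smul_comm, ← mul_assoc,
        ← function_mul_comm, mul_assoc, Fin.val_succ, pow_succ, mul_neg_one, neg_smul]
      simp

theorem contractR_wedge (c : ι) {r : ℕ} (X : Fin (r + 1) → ι → PolyFun ι) :
    contractR c (wedge X) = ∑ i : Fin (r + 1), (-1 : ℂ) ^ (r + i : ℕ) •
      ((X i c ⊗ₜ[ℂ] 1) * wedge fun k => X (i.succAbove k)) := by
  induction r with
  | zero =>
    rw [wedge_succ_last, contractR_mul_vectorField, wedge_zero, contractR_one]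
    simp [wedge_zero]
  | succ r ih =>
    rw [wedge_succ_last, contractR_mul_vectorField, ih, Fin.sum_univ_castSucc (n := r + 1),
      Finset.sum_mul,
      sub_eq_add_neg, ← Finset.sum_neg_distrib, add_comm]
    congr 1
    · refine Finset.sum_congr rfl fun j _ => ?_
      rw [wedge_succ_last fun k => X (j.castSucc.succAbove k), smul_mul_assoc, mul_assoc,
        Fin.val_castSucc, show r + 1 + (j : ℕ) = r + j + 1 by omega, pow_succ, mul_neg_one,
        neg_smul]
      simp
    · rw [Fin.val_last, ← two_mul, pow_mul]
      simp

theorem function_mul_vectorField (u : PolyFun ι) (f : ι → PolyFun ι) :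
    (u ⊗ₜ[ℂ] 1) * vectorField f = vectorField fun c => u * f c := by
  simp [vectorField, Finset.mul_sum]

theorem vectorField_sum_sub (f g : ι → ι → PolyFun ι) :
    (vectorField fun d => (∑ c, f c d) - ∑ c, g c d) =
      ∑ c, (vectorField (f c) - vectorField (g c)) := by
  simp only [vectorField, TensorProduct.sub_tmul, TensorProduct.sum_tmul, Finset.sum_sub_distrib]
  rw [Finset.sum_comm, Finset.sum_comm (f := fun d c => g c d ⊗ₜ[ℂ] _)]

/-- The formula for the Schouten bracket of two products of vector fields
(the indices start at `0`, which does not change the parity of the sum of two indices). -/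
theorem schouten_wedge {r s : ℕ} (X : Fin (r + 1) → ι → PolyFun ι)
    (Y : Fin (s + 1) → ι → PolyFun ι) :
    schouten (wedge X) (wedge Y) = ∑ i : Fin (r + 1), ∑ j : Fin (s + 1),
      (-1 : ℂ) ^ (i + j : ℕ) • (vectorField (fieldBracket (X i) (Y j)) *
        (wedge fun k => X (i.succAbove k)) * wedge fun k => Y (j.succAbove k)) := by
  have h1 : ∀ c, contractR c (wedge X) * coeffDeriv c (wedge Y) =
      ∑ i : Fin (r + 1), ∑ j : Fin (s + 1), (-1 : ℂ) ^ (i + j : ℕ) •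
        ((vectorField fun d => X i c * partialDeriv c (Y j d)) *
          (wedge fun k => X (i.succAbove k)) * wedge fun k => Y (j.succAbove k)) := by
    intro c
    rw [contractR_wedge, coeffDeriv_wedge, Finset.sum_mul_sum]
    refine Finset.sum_congr rfl fun i _ => Finset.sum_congr rfl fun j _ => ?_
    rw [smul_mul_smul_comm, mul_assoc, ← mul_assoc (wedge _), wedge_mul_vectorField,
      smul_mul_assoc, mul_smul_comm, smul_smul, ← function_mul_vectorField]
    simp only [mul_assoc]
    congr 1
    rw [pow_add, pow_add]
    have : (-1 : ℂ) ^ r * (-1 : ℂ) ^ r = 1 := by rw [← mul_pow]; simp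
    linear_combination ((-1 : ℂ) ^ (i : ℕ) * (-1 : ℂ) ^ (j : ℕ)) * this
  have h2 : ∀ c, coeffDeriv c (wedge X) * contractL c (wedge Y) =
      ∑ i : Fin (r + 1), ∑ j : Fin (s + 1), (-1 : ℂ) ^ (i + j : ℕ) •
        ((vectorField fun d => Y j c * partialDeriv c (X i d)) *
          (wedge fun k => X (i.succAbove k)) * wedge fun k => Y (j.succAbove k)) := by
    intro c
    rw [coeffDeriv_wedge, contractL_wedge, Finset.sum_mul_sum]
    refine Finset.sum_congr rfl fun i _ => Finset.sum_congr rfl fun j _ => ?_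
    rw [smul_mul_smul_comm, ← mul_assoc, ← function_mul_comm, ← function_mul_vectorField, pow_add]
    simp only [mul_assoc]
  rw [schouten_apply]
  simp only [h1, h2, ← Finset.sum_sub_distrib, ← smul_sub, ← sub_mul]
  rw [Finset.sum_comm]
  refine Finset.sum_congr rfl fun i _ => ?_
  rw [Finset.sum_comm]
  refine Finset.sum_congr rfl fun j _ => ?_
  rw [← Finset.smul_sum, ← Finset.sum_mul, ← Finset.sum_mul, ← vectorField_sum_sub]
  rfl

theorem schouten_wedge_function {r : ℕ} (X : Fin (r + 1) → ι → PolyFun ι) (u : PolyFun ι) :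
    schouten (wedge X) (u ⊗ₜ[ℂ] 1) = ∑ i : Fin (r + 1), (-1 : ℂ) ^ (r + i : ℕ) •
      ((fieldDeriv (X i) u ⊗ₜ[ℂ] 1) * wedge fun k => X (i.succAbove k)) := by
  have h1 : ∀ c, coeffDeriv c (u ⊗ₜ[ℂ] (1 : ExteriorAlgebra ℂ (ι → ℂ))) =
      partialDeriv c u ⊗ₜ[ℂ] 1 := fun c => by simp [coeffDeriv]
  have h2 : ∀ c, contractL c (u ⊗ₜ[ℂ] (1 : ExteriorAlgebra ℂ (ι → ℂ))) = 0 := fun c => by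
    simp [contractL]
  simp only [schouten_apply, h1, h2, mul_zero, sub_zero, contractR_wedge, Finset.sum_mul]
  rw [Finset.sum_comm]
  refine Finset.sum_congr rfl fun i _ => ?_
  simp only [fieldDeriv, TensorProduct.sum_tmul, Finset.sum_mul, Finset.smul_sum]
  refine Finset.sum_congr rfl fun c _ => ?_
  rw [smul_mul_assoc, ← function_mul_comm, ← mul_assoc]
  simp [mul_comm (X i c)]

theorem schouten_function_wedge {s : ℕ} (u : PolyFun ι) (Y : Fin (s + 1) → ι → PolyFun ι) :
    schouten (u ⊗ₜ[ℂ] 1) (wedge Y) = -∑ j : Fin (s + 1), (-1 : ℂ) ^ (j : ℕ) •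
      ((fieldDeriv (Y j) u ⊗ₜ[ℂ] 1) * wedge fun k => Y (j.succAbove k)) := by
  have h1 : ∀ c, coeffDeriv c (u ⊗ₜ[ℂ] (1 : ExteriorAlgebra ℂ (ι → ℂ))) =
      partialDeriv c u ⊗ₜ[ℂ] 1 := fun c => by simp [coeffDeriv]
  have h2 : ∀ c, contractR c (u ⊗ₜ[ℂ] (1 : ExteriorAlgebra ℂ (ι → ℂ))) = 0 := fun c => by
    simp [contractR]
  simp only [schouten_apply, h1, h2, zero_mul, zero_sub, contractL_wedge, Finset.mul_sum]
  rw [Finset.sum_neg_distrib, Finset.sum_comm]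
  congr 1
  refine Finset.sum_congr rfl fun i _ => ?_
  simp only [fieldDeriv, TensorProduct.sum_tmul, Finset.sum_mul, Finset.smul_sum]
  refine Finset.sum_congr rfl fun c _ => ?_
  rw [mul_smul_comm, ← mul_assoc]
  simp [mul_comm (Y i c)]

end Polyvector

/-! ### Representation spaces -/

section Representation

variable {I : Type*} [Quiver I]

/-- The coordinates on the representation space: `(a, m, n)` stands for the entry `(m, n)` of the
matrix `X_a`, of size `α_{h(a)} × α_{t(a)}`. -/
abbrev Coord (α : I → ℕ) : Type _ :=
  Σ a : Quiver.Total I, Fin (α a.right) × Fin (α a.left)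

/-- The space `Rep(Q, α)`, a point of which is given by the entries of the matrices `X_a`. -/
abbrev Rep (α : I → ℕ) : Type _ := Coord α → ℂ

variable {α : I → ℕ}

/-- The matrix `X_a` of a representation. -/
def repMatrix (X : Rep α) (a : Quiver.Total I) : Matrix (Fin (α a.right)) (Fin (α a.left)) ℂ :=
  Matrix.of fun m n => X ⟨a, m, n⟩

/-- The action of `G = ∏ᵢ GL(αᵢ)` on `Rep(Q, α)`: `(g X)_a = g_{h(a)} X_a g_{t(a)}⁻¹`. -/
def repAct (g : ∀ i, GL (Fin (α i)) ℂ) : Rep α →ₗ[ℂ] Rep α where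
  toFun X c := ((g c.1.right).val * repMatrix X c.1 * (g c.1.left)⁻¹.val) c.2.1 c.2.2
  map_add' X Y := by
    have h : ∀ a, repMatrix (X + Y) a = repMatrix X a + repMatrix Y a := fun a => rfl
    ext c
    simp only [h, Matrix.mul_add, Matrix.add_mul, Matrix.add_apply, Pi.add_apply]
  map_smul' t X := by
    have h : ∀ a, repMatrix (t • X) a = t • repMatrix X a := fun a => rfl
    ext c
    simp only [h, Matrix.mul_smul, Matrix.smul_mul, Matrix.smul_apply, Pi.smul_apply,
      RingHom.id_apply]

/-- `G`-invariance of a polyvector field `P` on `Rep(Q, α)`: `P(g X) = g_* P(X)`. -/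
def IsInvariant (P : PolyVector (Coord α)) : Prop :=
  ∀ (g : ∀ i, GL (Fin (α i)) ℂ) (X : Rep α),
    evalAt (repAct g X) P = ExteriorAlgebra.map (repAct g) (evalAt X P)

end Representation

/-! ### The trace map -/

section Trace

variable {I : Type*} [Quiver I] [DecidableEq I] [DecidableEq (Quiver.Total I)] {α : I → ℕ}

variable (α) in
/-- The index set of the `|α| × |α|` block matrices. -/
abbrev BlockIdx : Type _ := Σ i : I, Fin (α i)

/-- The block matrix with block `(i, j)` equal to `Z` and all other blocks `0`. -/
def block {S : Type*} [AddCommMonoid S] (i j : I) (Z : Matrix (Fin (α i)) (Fin (α j)) S) :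
    Matrix (BlockIdx α) (BlockIdx α) S :=
  ∑ m, ∑ n, Matrix.single ⟨i, m⟩ ⟨j, n⟩ (Z m n)

/-- The block matrix of an arrow of the double quiver: the matrix `X_a` of coordinate functions for
`a`, and for `a*` the matrix `Y_a` of the entries of a covector, viewed as linear functions of the
covector, i.e. as vector fields: a covector is a family `(Y_a)` paired with `(X_a)` by
`∑ₐ tr(Y_a X_a)`, so that the entry `(n, m)` of `Y_a` is the vector field `∂/∂(X_a)ₘₙ`. -/
def letterMatrix : DArrow I → Matrix (BlockIdx α) (BlockIdx α) (TensorField (Coord α))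
  | Sum.inl a => block a.right a.left
      (Matrix.of fun m n => coordFun ⟨a, m, n⟩ ⊗ₜ[ℂ] (1 : TensorAlgebra ℂ (Rep α)))
  | Sum.inr a => block a.left a.right
      (Matrix.of fun n m => (1 : PolyFun (Coord α)) ⊗ₜ[ℂ] TensorAlgebra.ι ℂ (Pi.single ⟨a, m, n⟩ 1 : Rep α))

variable [Fintype I]

/-- The matrix-valued contravariant tensor field of a path. The factor on the left is the matrix of
the trivial path at its head. -/
def pathPhi (p : DPath I) : Matrix (BlockIdx α) (BlockIdx α) (TensorField (Coord α)) :=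
  block p.head p.head 1 * (p.word.map letterMatrix).prod

variable (α) in
/-- The map `Φ` from the path algebra to matrix-valued contravariant tensor fields. -/
def Phi : PathAlg I →ₗ[ℂ] Matrix (BlockIdx α) (BlockIdx α) (TensorField (Coord α)) :=
  Finsupp.lift _ ℂ (DPath I) pathPhi

/-- The trace `tr_λ(Z) = ∑ᵢ λᵢ tr(Zᵢᵢ)`. -/
def weightedTrace {S : Type*} [AddCommMonoid S] [Module ℂ S] (l : I → ℂ) :
    Matrix (BlockIdx α) (BlockIdx α) S →ₗ[ℂ] S where
  toFun Z := ∑ i, l i • ∑ m, Z ⟨i, m⟩ ⟨i, m⟩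
  map_add' Y Z := by simp [Finset.sum_add_distrib]
  map_smul' c Z := by
    simp only [Matrix.smul_apply, ← Finset.smul_sum, RingHom.id_apply]
    rw [Finset.smul_sum]
    exact Finset.sum_congr rfl fun i _ => smul_comm _ _ _

variable (α) in
/-- The map `tr_λ ∘ Φ`, restricted to skew-symmetric covariant tensors, on the path algebra. -/
def algPsi (l : I → ℂ) : PathAlg I →ₗ[ℂ] PolyVector (Coord α) :=
  (skew (Coord α)).toLinearMap ∘ₗ weightedTrace l ∘ₗ Phi α

/-- The image of `pathPhi p` in matrices of polyvector fields. -/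
def skewPhi (p : DPath I) : Matrix (BlockIdx α) (BlockIdx α) (PolyVector (Coord α)) :=
  (skew (Coord α)).mapMatrix (pathPhi p)

/-- The image of `letterMatrix x` in matrices of polyvector fields. -/
def skewLetter (x : DArrow I) : Matrix (BlockIdx α) (BlockIdx α) (PolyVector (Coord α)) :=
  (skew (Coord α)).mapMatrix (letterMatrix x)

/-- The diagonal matrix equal to `f i` in the block `(i, i)`. -/
def blockDiag (f : I → ℂ) : Matrix (BlockIdx α) (BlockIdx α) (PolyVector (Coord α)) :=
  Matrix.diagonal fun r => algebraMap ℂ _ (f r.1)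

theorem block_apply_eq_zero {S : Type*} [AddCommMonoid S] {i j : I}
    (Z : Matrix (Fin (α i)) (Fin (α j)) S) {r c : BlockIdx α} (h : ¬(r.1 = i ∧ c.1 = j)) :
    block i j Z r c = 0 := by
  simp only [block, Matrix.sum_apply]
  refine Finset.sum_eq_zero fun m _ => Finset.sum_eq_zero fun n _ => ?_
  refine Matrix.single_apply_of_ne _ _ _ _ _ fun h' => h ⟨?_, ?_⟩
  · exact (congrArg Sigma.fst h'.1).symm
  · exact (congrArg Sigma.fst h'.2).symm

theorem block_one {S : Type*} [Semiring S] (i : I) :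
    block i i (1 : Matrix (Fin (α i)) (Fin (α i)) S) =
      Matrix.diagonal fun r : BlockIdx α => if r.1 = i then 1 else 0 := by
  ext ⟨r, m⟩ ⟨c, n⟩
  by_cases h : r = i ∧ c = i
  · obtain ⟨rfl, rfl⟩ := h
    simp only [block, Matrix.sum_apply, Matrix.single_apply, Sigma.mk.injEq, heq_eq_eq, true_and,
      Matrix.diagonal_apply, if_true, Matrix.one_apply]
    rw [Finset.sum_eq_single m, Finset.sum_eq_single n]
    · simp
    · intro b _ hb; simp [hb]
    · simp
    · intro b _ hb; simp [hb]
    · simp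
  · rw [block_apply_eq_zero _ h]
    by_cases h' : (⟨r, m⟩ : BlockIdx α) = ⟨c, n⟩
    · have e : r = c := congrArg Sigma.fst h'
      subst e
      simp only [and_self] at h
      simp [Matrix.diagonal_apply, h]
    · rw [Matrix.diagonal_apply_ne _ h']

theorem skewPhi_eq (p : DPath I) :
    (skewPhi p : Matrix (BlockIdx α) (BlockIdx α) _) =
      blockDiag (Pi.single p.head 1) * (p.word.map skewLetter).prod := by
  rw [skewPhi, pathPhi, map_mul, map_list_prod, List.map_map, block_one]
  congr 1
  ext r c
  by_cases h : r = c
  · subst h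
    by_cases h' : r.1 = p.head <;> simp [blockDiag, Pi.single_apply, h']
  · simp [blockDiag, h]

theorem blockDiag_mul (f g : I → ℂ) :
    (blockDiag f * blockDiag g : Matrix (BlockIdx α) (BlockIdx α) _) =
      blockDiag fun i => f i * g i := by
  simp [blockDiag]

theorem blockDiag_mul_single (f : I → ℂ) (i : I) :
    (blockDiag f * blockDiag (Pi.single i 1) : Matrix (BlockIdx α) (BlockIdx α) _) =
      f i • blockDiag (Pi.single i 1) := by
  rw [blockDiag_mul]
  ext r c
  by_cases h : r = c
  · subst h
    by_cases h' : r.1 = i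
    · subst h'; simp [blockDiag, Algebra.algebraMap_eq_smul_one]
    · simp [blockDiag, h']
  · simp [blockDiag, h]

theorem skewLetter_apply_eq_zero (x : DArrow I) {r c : BlockIdx α}
    (h : ¬(r.1 = dhead x ∧ c.1 = dtail x)) : skewLetter x r c = 0 := by
  rcases x with a | a
  · exact (congrArg (skew (Coord α)) (block_apply_eq_zero _ h)).trans (map_zero _)
  · exact (congrArg (skew (Coord α)) (block_apply_eq_zero _ h)).trans (map_zero _)

theorem blockDiag_mul_skewLetter (f : I → ℂ) (x : DArrow I) :
    (blockDiag f * skewLetter x : Matrix (BlockIdx α) (BlockIdx α) _) =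
      f (dhead x) • skewLetter x := by
  ext r c
  by_cases h : r.1 = dhead x ∧ c.1 = dtail x
  · rw [blockDiag, Matrix.diagonal_mul, Matrix.smul_apply, h.1, Algebra.smul_def]
  · rw [blockDiag, Matrix.diagonal_mul, Matrix.smul_apply, skewLetter_apply_eq_zero x h]
    simp

theorem skewLetter_mul_blockDiag (f : I → ℂ) (x : DArrow I) :
    (skewLetter x * blockDiag f : Matrix (BlockIdx α) (BlockIdx α) _) =
      f (dtail x) • skewLetter x := by
  ext r c
  by_cases h : r.1 = dhead x ∧ c.1 = dtail x
  · rw [blockDiag, Matrix.mul_diagonal, Matrix.smul_apply, h.2, Algebra.smul_def,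
      Algebra.commutes]
  · rw [blockDiag, Matrix.mul_diagonal, Matrix.smul_apply, skewLetter_apply_eq_zero x h]
    simp

theorem word_mul_blockDiag (f : I → ℂ) {i j : I} {w : List (DArrow I)} (h : IsPath i w j) :
    (blockDiag (Pi.single i 1) * (w.map skewLetter).prod * blockDiag f :
        Matrix (BlockIdx α) (BlockIdx α) _) =
      f j • (blockDiag (Pi.single i 1) * (w.map skewLetter).prod) := by
  induction w generalizing i with
  | nil =>
    obtain rfl : i = j := h
    rw [List.map_nil, List.prod_nil, mul_one, ← blockDiag_mul_single, blockDiag_mul, blockDiag_mul]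
    simp only [mul_comm]
  | cons x w ih =>
    have hx : (skewLetter x : Matrix (BlockIdx α) (BlockIdx α) _) =
        skewLetter x * blockDiag (Pi.single (dtail x) 1) := by
      rw [skewLetter_mul_blockDiag]; simp
    have := ih h.2
    rw [List.map_cons, List.prod_cons, hx, mul_assoc (skewLetter x), mul_assoc, mul_assoc, this,
      mul_smul_comm, mul_smul_comm]

theorem skewPhi_mul_blockDiag (f : I → ℂ) (p : DPath I) :
    (skewPhi p * blockDiag f : Matrix (BlockIdx α) (BlockIdx α) _) = f p.tail • skewPhi p := by
  rw [skewPhi_eq, word_mul_blockDiag f p.isPath]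

theorem blockDiag_mul_skewPhi (f : I → ℂ) (p : DPath I) :
    (blockDiag f * skewPhi p : Matrix (BlockIdx α) (BlockIdx α) _) = f p.head • skewPhi p := by
  rw [skewPhi_eq, ← mul_assoc, blockDiag_mul_single, smul_mul_assoc]

theorem skewPhi_append {p q : DPath I} (h : p.tail = q.head)
    (hw : IsPath p.head (p.word ++ q.word) q.tail) :
    (skewPhi ⟨p.head, q.tail, p.word ++ q.word, hw⟩ : Matrix (BlockIdx α) (BlockIdx α) _) =
      skewPhi p * skewPhi q := by
  have := skewPhi_mul_blockDiag (α := α) (Pi.single q.head 1) p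
  rw [h, Pi.single_eq_same, one_smul] at this
  rw [skewPhi_eq q, ← mul_assoc, this, skewPhi_eq, skewPhi_eq, List.map_append, List.prod_append,
    mul_assoc]

theorem algPsi_single (l : I → ℂ) (p : DPath I) :
    algPsi α l (Finsupp.single p 1) = l p.head • (skewPhi p).trace := by
  have e : algPsi α l (Finsupp.single p 1) = (blockDiag l * skewPhi p).trace := by
    have hPhi : Phi α (Finsupp.single p 1) = pathPhi p := by simp [Phi]
    rw [Matrix.trace, Fintype.sum_sigma, algPsi, LinearMap.comp_apply, LinearMap.comp_apply, hPhi]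
    change skew (Coord α) (∑ i, l i • ∑ m, pathPhi p ⟨i, m⟩ ⟨i, m⟩) = _
    rw [map_sum]
    refine Finset.sum_congr rfl fun i _ => ?_
    rw [map_smul, map_sum, Finset.smul_sum]
    refine Finset.sum_congr rfl fun m _ => ?_
    rw [Matrix.diag_apply, blockDiag, Matrix.diagonal_mul, Algebra.smul_def]
    rfl
  rw [e, blockDiag_mul_skewPhi, Matrix.trace_smul]

theorem skewPhi_mem_polyGrade (p : DPath I) (r c : BlockIdx α) :
    skewPhi p r c ∈ polyGrade (Coord α) p.deg := by
  have hl : ∀ (x : DArrow I) (r c : BlockIdx α),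
      skewLetter x r c ∈ polyGrade (Coord α) (dualDeg [x]) := by
    intro x r c
    rcases x with a | a <;>
      simp only [skewLetter, letterMatrix, AlgHom.mapMatrix_apply, Matrix.map_apply, block,
        Matrix.sum_apply, map_sum] <;>
      refine Submodule.sum_mem _ fun m _ => Submodule.sum_mem _ fun n _ => ?_ <;>
      rw [Matrix.single_apply] <;> split_ifs
    · refine (?_ : _ ∈ polyGrade (Coord α) 0)
      simpa [skew] using tmul_mem_polyGrade (r := 0) (coordFun _) (SetLike.GradedOne.one_mem)
    · simp
    · refine (?_ : _ ∈ polyGrade (Coord α) 1)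
      simpa [skew] using tmul_mem_polyGrade (r := 1) (1 : PolyFun (Coord α))
        (by simp : ExteriorAlgebra.ι ℂ (Pi.single _ 1) ∈ ⋀[ℂ]^1 (Coord α → ℂ))
    · simp
  have hw : ∀ (w : List (DArrow I)) (r c : BlockIdx α),
      (w.map skewLetter).prod r c ∈ polyGrade (Coord α) (dualDeg w) := by
    intro w
    induction w with
    | nil =>
      intro r c
      rw [List.map_nil, List.prod_nil, Matrix.one_apply]
      split_ifs
      · exact one_mem_polyGrade
      · exact zero_mem _
    | cons x w ih =>
      intro r c
      rw [List.map_cons, List.prod_cons, Matrix.mul_apply, ← List.singleton_append,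
        dualDeg_append]
      exact Submodule.sum_mem _ fun k _ => mul_mem_polyGrade (hl x r k) (ih k c)
  rw [skewPhi_eq, blockDiag, Matrix.diagonal_mul, ← Algebra.smul_def]
  exact Submodule.smul_mem _ _ (hw p.word r c)

theorem trace_skewPhi_mul (p q : DPath I) :
    (skewPhi p * skewPhi q : Matrix (BlockIdx α) (BlockIdx α) _).trace =
      (-1 : ℂ) ^ (p.deg * q.deg) • (skewPhi q * skewPhi p).trace := by
  simp only [Matrix.trace, Matrix.diag_apply, Matrix.mul_apply]
  rw [Finset.sum_comm, Finset.smul_sum]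
  refine Finset.sum_congr rfl fun r _ => ?_
  rw [Finset.smul_sum]
  exact Finset.sum_congr rfl fun c _ =>
    mul_comm_polyGrade (skewPhi_mem_polyGrade p c r) (skewPhi_mem_polyGrade q r c)

theorem trace_skewPhi_eq_zero (p : DPath I) (h : p.head ≠ p.tail) :
    (skewPhi p : Matrix (BlockIdx α) (BlockIdx α) _).trace = 0 := by
  have h1 := skewPhi_mul_blockDiag (α := α) (Pi.single p.tail 1) p
  have h2 := blockDiag_mul_skewPhi (α := α) (Pi.single p.tail 1) p
  rw [Pi.single_eq_same, one_smul] at h1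
  rw [Pi.single_eq_of_ne h, zero_smul] at h2
  rw [← h1]
  have : (skewPhi p * blockDiag (Pi.single p.tail 1) : Matrix (BlockIdx α) (BlockIdx α) _).trace =
      (blockDiag (Pi.single p.tail 1) * skewPhi p).trace := by
    simp only [Matrix.trace, Matrix.diag_apply, blockDiag, Matrix.mul_diagonal,
      Matrix.diagonal_mul, Algebra.commutes]
  rw [this, h2, Matrix.trace_zero]

theorem IsPath.map_eq {l : I → ℂ} (hl : ∀ a : Quiver.Total I, l a.right = l a.left)
    {i j : I} {w : List (DArrow I)} (h : IsPath i w j) : l i = l j := by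
  induction w generalizing i with
  | nil => exact congrArg l h
  | cons x w ih =>
    rw [← h.1, ← ih h.2]
    rcases x with a | a
    · exact hl a
    · exact (hl a).symm

theorem superCommutators_le_ker_algPsi (l : I → ℂ)
    (hl : ∀ a : Quiver.Total I, l a.right = l a.left) :
    superCommutators I ≤ LinearMap.ker (algPsi α l) :=
  superCommutators_le fun p q => by
    rw [LinearMap.mem_ker, map_sub, map_smul, sub_eq_zero]
    by_cases h : p.tail = q.head <;> by_cases h' : q.tail = p.head
    · obtain ⟨hw, e⟩ := compose_of_isPath h
      obtain ⟨hw', e'⟩ := compose_of_isPath h'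
      rw [e, e', algPsi_single, algPsi_single, skewPhi_append h, skewPhi_append h',
        trace_skewPhi_mul, smul_comm]
      dsimp only
      rw [p.isPath.map_eq hl, h]
    · obtain ⟨hw, e⟩ := compose_of_isPath h
      rw [e, compose, if_neg h', algPsi_single, trace_skewPhi_eq_zero _ (Ne.symm h')]
      simp
    · obtain ⟨hw, e⟩ := compose_of_isPath h'
      rw [e, compose, if_neg h, algPsi_single, trace_skewPhi_eq_zero _ (Ne.symm h)]
      simp
    · simp [compose, h, h']

variable (α) in
/-- The map `Ψ_λ : 𝒱Q → 𝒱(Rep(Q, α))`, for weights `λ` that agree at the endpoints of every arrow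
(otherwise `tr_λ ∘ Φ` need not descend to `𝒱Q`). -/
def Psi (l : I → ℂ) (hl : ∀ a : Quiver.Total I, l a.right = l a.left) :
    NecklaceSpace I →ₗ[ℂ] PolyVector (Coord α) :=
  (superCommutators I).liftQ (algPsi α l) (superCommutators_le_ker_algPsi l hl)

end Trace

end Necklace
end

/-! On a path, `Ψ_λ` is a weighted trace of a product of letter matrices, so everything reduces to
how derivations and the group act on such a product.

Brackets. In coordinates the Schouten bracket is a sum over the entries `c = (a, m, n)` of a right
contraction `contractR c` times a derivative `coeffDeriv c`, minus a mirror term. Both operators are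
right superderivations, and each sends exactly one letter entry to `1` and all others to `0`: the
`(m, n)` entry of the matrix of `a`, respectively the `(n, m)` entry of that of `a*`
(`IsLetterDerivation`). Applied to the trace of a word, such an operator opens the cyclic word at
every occurrence of its letter; bringing the two pieces into cyclic order by graded commutativity
produces exactly the signs of the directional superderivative. Hence the operator attached to a
letter `y` turns `Ψ_λ(x)` into `λ` at the head of `y` times one entry of the matrix of `D_y(x)`
(`IsLetterDerivation.algPsi`). Summing over `m` and `n` multiplies the two matrices and takes the
trace (`sum_sum_pathMatrix_algD`). The two operators contribute the weights of both ends of `a`,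
which are equal, so the result carries `λ²`. The mirror term acquires the sign of the necklace
bracket by `coeffDeriv_mul_contractL`. A Poisson element therefore has a Poisson image.

Invariance. At `gX` the matrix of a letter is `g` times its push-forward from `X` times `g⁻¹`
(`evalAtHom_repAct_skewLetter`). Along a word the inner factors cancel, and the trace removes the
outer ones because their entries are scalars. -/

noncomputable section

namespace Necklace

/-! ### Contractions as superderivations of the exterior algebra and of polyvector fields. -/

section Contraction

variable {ι : Type*}

/-- Right contraction of the exterior algebra with the covector `d`. -/
def exteriorContractR (d : Module.Dual ℂ (ι → ℂ)) :
    ExteriorAlgebra ℂ (ι → ℂ) →ₗ[ℂ] ExteriorAlgebra ℂ (ι → ℂ) :=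
  CliffordAlgebra.contractRight.flip d

/-- Left contraction of the exterior algebra with the covector `d`. -/
def exteriorContractL (d : Module.Dual ℂ (ι → ℂ)) :
    ExteriorAlgebra ℂ (ι → ℂ) →ₗ[ℂ] ExteriorAlgebra ℂ (ι → ℂ) :=
  CliffordAlgebra.contractLeft d

theorem exteriorContractR_algebraMap (d : Module.Dual ℂ (ι → ℂ)) (t : ℂ) :
    exteriorContractR d (algebraMap ℂ _ t) = 0 :=
  CliffordAlgebra.contractRight_algebraMap _ d t

theorem exteriorContractR_mul_algebraMap (d : Module.Dual ℂ (ι → ℂ))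
    (x : ExteriorAlgebra ℂ (ι → ℂ)) (t : ℂ) :
    exteriorContractR d (x * algebraMap ℂ _ t) = exteriorContractR d x * algebraMap ℂ _ t :=
  CliffordAlgebra.contractRight_mul_algebraMap d x t

theorem exteriorContractR_mul_ι (d : Module.Dual ℂ (ι → ℂ)) (x : ExteriorAlgebra ℂ (ι → ℂ))
    (v : ι → ℂ) :
    exteriorContractR d (x * ExteriorAlgebra.ι ℂ v) =
      d v • x - exteriorContractR d x * ExteriorAlgebra.ι ℂ v :=
  CliffordAlgebra.contractRight_mul_ι d v x

theorem exteriorContractR_ι (d : Module.Dual ℂ (ι → ℂ)) (v : ι → ℂ) :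
    exteriorContractR d (ExteriorAlgebra.ι ℂ v) = algebraMap ℂ _ (d v) := by
  have h := exteriorContractR_mul_ι d 1 v
  rwa [one_mul, ← map_one (algebraMap ℂ (ExteriorAlgebra ℂ (ι → ℂ))),
    exteriorContractR_algebraMap, zero_mul, sub_zero, map_one,
    ← Algebra.algebraMap_eq_smul_one] at h

theorem exteriorContractL_ι_mul (d : Module.Dual ℂ (ι → ℂ)) (x : ExteriorAlgebra ℂ (ι → ℂ))
    (v : ι → ℂ) :
    exteriorContractL d (ExteriorAlgebra.ι ℂ v * x) =
      d v • x - ExteriorAlgebra.ι ℂ v * exteriorContractL d x :=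
  CliffordAlgebra.contractLeft_ι_mul d v x

theorem exteriorContractL_algebraMap (d : Module.Dual ℂ (ι → ℂ)) (t : ℂ) :
    exteriorContractL d (algebraMap ℂ _ t) = 0 :=
  CliffordAlgebra.contractLeft_algebraMap _ d t

/-- Right contraction acts from the right end, so it has to pass `y` before it reaches `x`; only `y`
needs to be homogeneous. The induction strips vectors off the right end of `y`, where the defining
recursion applies. -/
theorem exteriorContractR_mul (d : Module.Dual ℂ (ι → ℂ)) (x : ExteriorAlgebra ℂ (ι → ℂ))
    {s : ℕ} {y : ExteriorAlgebra ℂ (ι → ℂ)} (hy : y ∈ ⋀[ℂ]^s (ι → ℂ)) :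
    exteriorContractR d (x * y) =
      x * exteriorContractR d y + (-1 : ℂ) ^ s • (exteriorContractR d x * y) := by
  induction hy using Submodule.pow_induction_on_right' with
  | algebraMap t =>
    rw [exteriorContractR_algebraMap, exteriorContractR_mul_algebraMap]
    simp
  | add y z i hy hz h h' =>
    rw [mul_add, map_add, h, h', map_add, mul_add, mul_add, smul_add]
    abel
  | mul_mem i y hy h m hm =>
    obtain ⟨v, rfl⟩ := hm
    rw [← mul_assoc, exteriorContractR_mul_ι, exteriorContractR_mul_ι, h, mul_sub, add_mul,
      pow_succ, mul_neg_one, neg_smul, mul_smul_comm, smul_mul_assoc, mul_assoc, mul_assoc]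
    abel

/-- Moving the contraction from the left end to the right end passes the `s - 1` remaining factors.
The exponent `s + 1` has the same parity and avoids truncated subtraction; for `s = 0` both sides
vanish. -/
theorem exteriorContractL_eq (d : Module.Dual ℂ (ι → ℂ))
    {s : ℕ} {y : ExteriorAlgebra ℂ (ι → ℂ)} (hy : y ∈ ⋀[ℂ]^s (ι → ℂ)) :
    exteriorContractL d y = (-1 : ℂ) ^ (s + 1) • exteriorContractR d y := by
  induction hy using Submodule.pow_induction_on_left' with
  | algebraMap t => rw [exteriorContractR_algebraMap, exteriorContractL_algebraMap, smul_zero]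
  | add y z i hy hz h h' => rw [map_add, h, h', map_add, smul_add]
  | mem_mul m hm i y hy h =>
    obtain ⟨v, rfl⟩ := hm
    rw [exteriorContractL_ι_mul, h, exteriorContractR_mul d _ hy, exteriorContractR_ι, ← Algebra.smul_def,
      smul_add, smul_smul, mul_smul_comm]
    have e : (-1 : ℂ) ^ (i + 1 + 1) * (-1) ^ i = 1 := by
      rw [← pow_add, show i + 1 + 1 + i = 2 * (i + 1) by ring, pow_mul]
      simp
    rw [Nat.succ_eq_add_one, e, one_smul, pow_succ _ (i + 1), mul_neg_one, neg_smul]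
    abel

theorem exteriorContractR_zero (d : Module.Dual ℂ (ι → ℂ)) {y : ExteriorAlgebra ℂ (ι → ℂ)}
    (hy : y ∈ ⋀[ℂ]^0 (ι → ℂ)) : exteriorContractR d y = 0 := by
  rw [ExteriorAlgebra.exteriorPower, pow_zero] at hy
  obtain ⟨t, rfl⟩ := Submodule.mem_one.1 hy
  exact exteriorContractR_algebraMap d t

theorem exteriorContractR_mem (d : Module.Dual ℂ (ι → ℂ)) {s : ℕ}
    {y : ExteriorAlgebra ℂ (ι → ℂ)} (hy : y ∈ ⋀[ℂ]^(s + 1) (ι → ℂ)) :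
    exteriorContractR d y ∈ ⋀[ℂ]^s (ι → ℂ) := by
  induction s generalizing y with
  | zero =>
    rw [zero_add, ExteriorAlgebra.exteriorPower, pow_one] at hy
    obtain ⟨v, rfl⟩ := hy
    rw [exteriorContractR_ι, ExteriorAlgebra.exteriorPower, pow_zero]
    exact Submodule.algebraMap_mem _
  | succ s ih =>
    rw [ExteriorAlgebra.exteriorPower, pow_succ] at hy
    induction hy using Submodule.mul_induction_on' with
    | mem_mul_mem x hx m hm =>
      obtain ⟨v, rfl⟩ := hm
      rw [exteriorContractR_mul_ι, ExteriorAlgebra.exteriorPower, pow_succ]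
      refine sub_mem (Submodule.smul_mem _ _ ?_)
        (Submodule.mul_mem_mul (ih hx) (LinearMap.mem_range_self _ v))
      rwa [← pow_succ]
    | add x _ y _ hx hy => rw [map_add]; exact add_mem hx hy

theorem contractR_tmul (c : ι) (f : PolyFun ι) (x : ExteriorAlgebra ℂ (ι → ℂ)) :
    contractR c (f ⊗ₜ[ℂ] x) = f ⊗ₜ[ℂ] exteriorContractR (LinearMap.proj c) x :=
  rfl

theorem contractL_tmul (c : ι) (f : PolyFun ι) (x : ExteriorAlgebra ℂ (ι → ℂ)) :
    contractL c (f ⊗ₜ[ℂ] x) = f ⊗ₜ[ℂ] exteriorContractL (LinearMap.proj c) x :=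
  rfl

theorem contractR_mul (c : ι) (P : PolyVector ι) {s : ℕ} {R : PolyVector ι}
    (hR : R ∈ polyGrade ι s) :
    contractR c (P * R) = P * contractR c R + (-1 : ℂ) ^ s • (contractR c P * R) := by
  induction P using TensorProduct.induction_on with
  | zero => simp
  | add P P' hP hP' =>
    rw [add_mul, map_add, hP, hP', map_add, add_mul, add_mul, smul_add]
    abel
  | tmul f x =>
    refine polyGrade_induction (S := LinearMap.eqLocus
      (contractR c ∘ₗ LinearMap.mul ℂ (PolyVector ι) (f ⊗ₜ[ℂ] x))
      (LinearMap.mul ℂ (PolyVector ι) (f ⊗ₜ[ℂ] x) ∘ₗ contractR c +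
        (-1 : ℂ) ^ s • LinearMap.mul ℂ (PolyVector ι) (contractR c (f ⊗ₜ[ℂ] x))))
      (fun g y hy => ?_) hR
    change contractR c ((f ⊗ₜ[ℂ] x) * (g ⊗ₜ[ℂ] y)) = (f ⊗ₜ[ℂ] x) * contractR c (g ⊗ₜ[ℂ] y) +
      (-1 : ℂ) ^ s • (contractR c (f ⊗ₜ[ℂ] x) * (g ⊗ₜ[ℂ] y))
    simp only [contractR_tmul, Algebra.TensorProduct.tmul_mul_tmul]
    rw [exteriorContractR_mul _ _ hy, TensorProduct.tmul_add, TensorProduct.tmul_smul]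

theorem contractL_eq_contractR (c : ι) {s : ℕ} {P : PolyVector ι} (hP : P ∈ polyGrade ι s) :
    contractL c P = (-1 : ℂ) ^ (s + 1) • contractR c P := by
  refine polyGrade_induction (S := LinearMap.eqLocus (contractL c)
    ((-1 : ℂ) ^ (s + 1) • contractR c)) (fun g y hy => ?_) hP
  change contractL c (g ⊗ₜ[ℂ] y) = (-1 : ℂ) ^ (s + 1) • contractR c (g ⊗ₜ[ℂ] y)
  rw [contractL_tmul, contractR_tmul, exteriorContractL_eq _ hy, TensorProduct.tmul_smul]

theorem contractR_polyGrade_zero (c : ι) {P : PolyVector ι} (hP : P ∈ polyGrade ι 0) :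
    contractR c P = 0 := by
  refine polyGrade_induction (S := LinearMap.ker (contractR c)) (fun g y hy => ?_) hP
  rw [LinearMap.mem_ker, contractR_tmul, exteriorContractR_zero _ hy, TensorProduct.tmul_zero]

theorem contractR_mem_polyGrade (c : ι) {s : ℕ} {P : PolyVector ι}
    (hP : P ∈ polyGrade ι (s + 1)) : contractR c P ∈ polyGrade ι s := by
  refine polyGrade_induction (S := (polyGrade ι s).comap (contractR c)) (fun g y hy => ?_) hP
  exact tmul_mem_polyGrade g (exteriorContractR_mem _ hy)

theorem coeffDeriv_mem_polyGrade (c : ι) {s : ℕ} {P : PolyVector ι} (hP : P ∈ polyGrade ι s) :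
    coeffDeriv c P ∈ polyGrade ι s := by
  refine polyGrade_induction (S := (polyGrade ι s).comap (coeffDeriv c)) (fun g y hy => ?_) hP
  exact tmul_mem_polyGrade (partialDeriv c g) hy

/-- This makes the second term of the Schouten bracket the first one with the arguments exchanged,
up to the necklace sign: `s + 1` signs come from passing to the right contraction and `r (s - 1)`
from exchanging the factors. -/
theorem coeffDeriv_mul_contractL (c : ι) {r s : ℕ} {P R : PolyVector ι}
    (hP : P ∈ polyGrade ι r) (hR : R ∈ polyGrade ι s) :
    coeffDeriv c P * contractL c R =
      (-1 : ℂ) ^ ((r + 1) * (s + 1)) • (contractR c R * coeffDeriv c P) := by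
  rw [contractL_eq_contractR c hR, mul_smul_comm]
  cases s with
  -- Degree zero is separate: the contraction would have degree `-1`, and it vanishes.
  | zero => rw [contractR_polyGrade_zero c hR, mul_zero, zero_mul, smul_zero, smul_zero]
  | succ s =>
    rw [mul_comm_polyGrade (coeffDeriv_mem_polyGrade c hP) (contractR_mem_polyGrade c hR),
      smul_smul, ← pow_add, show (r + 1) * (s + 1 + 1) = s + 1 + 1 + r * s + 2 * r by ring,
      pow_add _ _ (2 * r), pow_mul _ 2, neg_one_sq, one_pow, mul_one]

end Contraction

/-! ### The matrix of a word and the multiplicativity of the matrix of a path. -/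

section Words

variable {I : Type*} [Quiver I] [DecidableEq I] [DecidableEq (Quiver.Total I)] [Fintype I]
  {α : I → ℕ}

variable (α) in
/-- The product of the matrices of polyvector fields of the letters of a word. -/
def wordMatrix (w : List (DArrow I)) : Matrix (BlockIdx α) (BlockIdx α) (PolyVector (Coord α)) :=
  (w.map skewLetter).prod

theorem wordMatrix_cons (x : DArrow I) (w : List (DArrow I)) :
    wordMatrix α (x :: w) = skewLetter x * wordMatrix α w := by
  simp [wordMatrix]

theorem wordMatrix_append (u v : List (DArrow I)) :
    wordMatrix α (u ++ v) = wordMatrix α u * wordMatrix α v := by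
  simp [wordMatrix]

theorem skewPhi_eq_wordMatrix (p : DPath I) :
    skewPhi p = blockDiag (Pi.single p.head 1) * wordMatrix α p.word :=
  skewPhi_eq p

theorem skewPhi_apply (p : DPath I) (r s : BlockIdx α) :
    skewPhi p r s = if r.1 = p.head then wordMatrix α p.word r s else 0 := by
  rw [skewPhi_eq_wordMatrix, blockDiag, Matrix.diagonal_mul, Pi.single_apply]
  split_ifs
  · rw [map_one, one_mul]
  · rw [map_zero, zero_mul]

theorem skewLetter_mem_polyGrade (x : DArrow I) (r s : BlockIdx α) :
    skewLetter x r s ∈ polyGrade (Coord α) (dualDeg [x]) := by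
  -- A letter is a path of length one, and the idempotent at its head fixes its matrix.
  have h := skewPhi_mem_polyGrade (α := α) ⟨dhead x, dtail x, [x], rfl, rfl⟩ r s
  rw [skewPhi_eq] at h
  simpa [blockDiag_mul_skewLetter, DPath.deg] using h

theorem wordMatrix_mem_polyGrade (w : List (DArrow I)) (r s : BlockIdx α) :
    wordMatrix α w r s ∈ polyGrade (Coord α) (dualDeg w) := by
  induction w generalizing r with
  | nil =>
    rw [wordMatrix, List.map_nil, List.prod_nil, Matrix.one_apply]
    split_ifs
    · exact one_mem_polyGrade
    · exact zero_mem _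
  | cons x w ih =>
    rw [wordMatrix_cons, Matrix.mul_apply, ← List.singleton_append, dualDeg_append]
    exact Submodule.sum_mem _ fun t _ => mul_mem_polyGrade (skewLetter_mem_polyGrade x r t) (ih t)

/-- A nonzero entry needs a chain of nonzero letter blocks, and such a chain is a path. This is what
makes the value `0` of `ofWord` on words that are not paths compatible with matrix products. -/
theorem wordMatrix_apply_eq_zero {w : List (DArrow I)} {r s : BlockIdx α}
    (h : ¬ IsPath r.1 w s.1) : wordMatrix α w r s = 0 := by
  induction w generalizing r with
  | nil =>
    rw [wordMatrix, List.map_nil, List.prod_nil, Matrix.one_apply_ne]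
    rintro rfl
    exact h rfl
  | cons x w ih =>
    rw [wordMatrix_cons, Matrix.mul_apply]
    refine Finset.sum_eq_zero fun t _ => ?_
    by_cases hx : r.1 = dhead x ∧ t.1 = dtail x
    · rw [ih, mul_zero]
      rw [hx.2]
      exact fun hw => h ⟨hx.1.symm, hw⟩
    · rw [skewLetter_apply_eq_zero x hx, zero_mul]

variable (α) in
/-- The linear extension of `skewPhi` to the path algebra. -/
def pathMatrix : PathAlg I →ₗ[ℂ] Matrix (BlockIdx α) (BlockIdx α) (PolyVector (Coord α)) :=
  Finsupp.lift _ ℂ (DPath I) skewPhi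

@[simp]
theorem pathMatrix_single (p : DPath I) :
    pathMatrix α (Finsupp.single p 1) = skewPhi p := by
  simp [pathMatrix]

theorem pathMatrix_ofWord_apply (i j : I) (w : List (DArrow I)) (r s : BlockIdx α) :
    pathMatrix α (ofWord i w j) r s =
      if r.1 = i ∧ s.1 = j then wordMatrix α w r s else 0 := by
  by_cases h : IsPath i w j
  · rw [ofWord_of_isPath h, pathMatrix_single, skewPhi_apply]
    by_cases hr : r.1 = i <;> by_cases hs : s.1 = j <;> simp only [hr, hs, if_true, and_true,
      and_false, if_false]
    -- The word and its head determine its tail, so the columns outside block `j` vanish.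
    refine wordMatrix_apply_eq_zero fun h' => hs ?_
    rw [hr] at h'
    exact h'.tail_unique h
  · rw [ofWord, dif_neg h, map_zero]
    split_ifs with hrs
    · rw [wordMatrix_apply_eq_zero, Matrix.zero_apply]
      rwa [hrs.1, hrs.2]
    · rfl

theorem skewPhi_mul_skewPhi (p q : DPath I) :
    (skewPhi p * skewPhi q : Matrix (BlockIdx α) (BlockIdx α) _) =
      pathMatrix α (compose p q) := by
  by_cases h : p.tail = q.head
  · obtain ⟨hw, e⟩ := compose_of_isPath h
    rw [e, pathMatrix_single, skewPhi_append h]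
  -- If the paths are not composable, the idempotent at the tail of `p`, inserted in the middle,
  -- kills `skewPhi q`.
  · have h1 := skewPhi_mul_blockDiag (α := α) (Pi.single p.tail 1) p
    have h2 := blockDiag_mul_skewPhi (α := α) (Pi.single p.tail 1) q
    rw [Pi.single_eq_same, one_smul] at h1
    rw [Pi.single_eq_of_ne (Ne.symm h), zero_smul] at h2
    rw [compose, if_neg h, map_zero, ← h1, mul_assoc, h2, mul_zero]

theorem pathMatrix_pathMul (x y : PathAlg I) :
    pathMatrix α (pathMul x y) = pathMatrix α x * pathMatrix α y := by
  have h : (pathMul (I := I)).compr₂ (pathMatrix α) =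
      (LinearMap.mul ℂ (Matrix (BlockIdx α) (BlockIdx α) (PolyVector (Coord α)))).compl₁₂
        (pathMatrix α) (pathMatrix α) := by
    refine Finsupp.lhom_ext' fun p => LinearMap.ext_ring (Finsupp.lhom_ext' fun q =>
      LinearMap.ext_ring ?_)
    simp [skewPhi_mul_skewPhi]
  exact LinearMap.congr_fun₂ h x y

theorem algPsi_eq_trace (l : I → ℂ) (x : PathAlg I) :
    algPsi α l x = (blockDiag l * pathMatrix α x).trace := by
  have h : algPsi α l = Matrix.traceLinearMap _ ℂ _ ∘ₗ
      LinearMap.mulLeft ℂ (blockDiag l) ∘ₗ pathMatrix α := by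
    refine Finsupp.lhom_ext' fun p => LinearMap.ext_ring ?_
    simp [algPsi_single, blockDiag_mul_skewPhi]
  exact LinearMap.congr_fun h x

theorem algPsi_mem_polyGrade (l : I → ℂ) {r : ℕ} {x : PathAlg I} (hx : x ∈ pathGrade I r) :
    algPsi α l x ∈ polyGrade (Coord α) r := by
  refine (Submodule.span_le (p := (polyGrade (Coord α) r).comap (algPsi α l))).2 ?_ hx
  rintro _ ⟨p, rfl, rfl⟩
  change algPsi α l _ ∈ polyGrade (Coord α) _
  rw [algPsi_single]
  exact Submodule.smul_mem _ _ (Submodule.sum_mem _ fun r _ => skewPhi_mem_polyGrade p r r)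

end Words

/-! ### Superderivations that detect one matrix entry of one letter. -/

section TwistedDerivation

variable {I : Type*} [Quiver I] [DecidableEq I] [DecidableEq (Quiver.Total I)] [Fintype I]
  {α : I → ℕ}

/-- A twisted derivation of the polyvector fields whose only nonzero value on the entries of the
matrices of letters is `1`, at the entry `(R, C)` of the matrix of `y`. -/
structure IsLetterDerivation (y : DArrow I) (R C : BlockIdx α)
    (T : PolyVector (Coord α) →ₗ[ℂ] PolyVector (Coord α)) : Prop where
  mul : ∀ (P : PolyVector (Coord α)) {s : ℕ} {S : PolyVector (Coord α)},
    S ∈ polyGrade (Coord α) s →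
      T (P * S) = P * T S + (-1 : ℂ) ^ (dualDeg [y] * s) • (T P * S)
  letter : ∀ (x : DArrow I) (r s : BlockIdx α),
    T (skewLetter x r s) = if x = y ∧ r = R ∧ s = C then 1 else 0
  row : R.1 = dhead y
  col : C.1 = dtail y

namespace IsLetterDerivation

variable {y : DArrow I} {R C : BlockIdx α} {T : PolyVector (Coord α) →ₗ[ℂ] PolyVector (Coord α)}

theorem map_one (hT : IsLetterDerivation y R C T) : T 1 = 0 := by
  have h := hT.mul 1 one_mem_polyGrade
  simpa using h

/-- Leibniz rule: an occurrence of `y` is replaced by a matrix unit, which splits the entry into one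
of the prefix and one of the suffix. The sign is the cost of passing the suffix. -/
theorem wordMatrix (hT : IsLetterDerivation y R C T) (w : List (DArrow I)) (r s : BlockIdx α) :
    T (wordMatrix α w r s) = ∑ k ∈ Finset.range w.length,
      if w[k]? = some y then (-1 : ℂ) ^ (dualDeg [y] * dualDeg (w.drop (k + 1))) •
        (Necklace.wordMatrix α (w.take k) r R * Necklace.wordMatrix α (w.drop (k + 1)) C s)
      else 0 := by
  induction w generalizing r with
  | nil =>
    rw [Necklace.wordMatrix, List.map_nil, List.prod_nil, Matrix.one_apply]
    split_ifs <;> simp [hT.map_one]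
  | cons x w ih =>
    -- The term `k = 0`, split off here, is the derivative of the first letter; the shifted terms
    -- come from the induction hypothesis.
    rw [wordMatrix_cons, Matrix.mul_apply, map_sum, List.length_cons, Finset.sum_range_succ']
    simp only [hT.mul _ (wordMatrix_mem_polyGrade w _ s), Finset.sum_add_distrib, ih,
      Finset.mul_sum, hT.letter]
    congr 1
    · rw [Finset.sum_comm]
      refine Finset.sum_congr rfl fun k _ => ?_
      simp only [List.getElem?_cons_succ, List.drop_succ_cons, List.take_succ_cons,
        wordMatrix_cons, Matrix.mul_apply]
      split_ifs
      · simp only [Finset.sum_mul, Finset.smul_sum, mul_assoc, mul_smul_comm]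
      · simp
    · by_cases hx : x = y
      · subst hx
        by_cases hr : r = R
        · subst hr
          simp [Necklace.wordMatrix]
        · simp [Necklace.wordMatrix, hr, Matrix.one_apply_ne]
      · simp [hx]

theorem dualDeg_take_succ {w : List (DArrow I)} {k : ℕ} (h : w[k]? = some y) :
    dualDeg (w.take (k + 1)) = dualDeg (w.take k) + dualDeg [y] := by
  rw [List.take_add_one, h, dualDeg_append]
  rfl

/-- Here the sign of `D_y` arises. With `u` the prefix and `v` the suffix, the Leibniz rule gives
the exponent `deg y · deg v` and exchanging `u` with `v` gives `deg u · deg v`. Their sum is `deg v`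
times the degree of `u y`, which is the product `ν μ`. -/
theorem trace_wordMatrix (hT : IsLetterDerivation y R C T) (w : List (DArrow I)) :
    T (Necklace.wordMatrix α w).trace = pathMatrix α (cutSum y w) C R := by
  rw [Matrix.trace, map_sum]
  simp only [Matrix.diag_apply, hT.wordMatrix]
  rw [Finset.sum_comm, cutSum, map_sum, Matrix.sum_apply]
  refine Finset.sum_congr rfl fun k _ => ?_
  split_ifs with hk
  · rw [map_smul, Matrix.smul_apply, pathMatrix_ofWord_apply, if_pos ⟨hT.col, hT.row⟩,
      wordMatrix_append, Matrix.mul_apply, Finset.smul_sum]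
    refine Finset.sum_congr rfl fun r _ => ?_
    rw [mul_comm_polyGrade (wordMatrix_mem_polyGrade _ _ _) (wordMatrix_mem_polyGrade _ _ _),
      smul_smul, ← pow_add, dualDeg_take_succ hk]
    congr 2
    ring
  · simp

/-- The weight is constant along a path, so for every path through `y` the weight at its head can be
read off at the head of `y`. -/
theorem algPsi (hT : IsLetterDerivation y R C T) {l : I → ℂ}
    (hl : ∀ a : Quiver.Total I, l a.right = l a.left) (x : PathAlg I) :
    T (algPsi α l x) = l (dhead y) • pathMatrix α (algD y x) C R := by
  have key : T ∘ₗ Necklace.algPsi α l =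
      l (dhead y) • Matrix.entryLinearMap ℂ _ C R ∘ₗ pathMatrix α ∘ₗ algD y := by
    refine Finsupp.lhom_ext' fun p => LinearMap.ext_ring ?_
    change T (Necklace.algPsi α l (Finsupp.single p 1)) =
      l (dhead y) • pathMatrix α (algD y (Finsupp.single p 1)) C R
    rw [algPsi_single, algD_single, pathD]
    split_ifs with h
    -- If `y` occurs, the word is nonempty, its first letter already forces the head block, and the
    -- idempotent in `skewPhi` is redundant. Otherwise both sides vanish, whatever the weights; this
    -- covers the trivial paths.
    · by_cases hy : y ∈ p.word
      · have hp : skewPhi p = Necklace.wordMatrix α p.word := by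
          ext r s
          rw [skewPhi_apply]
          split_ifs with hr
          · rfl
          · rw [wordMatrix_apply_eq_zero]
            intro h'
            obtain ⟨x, w, hw⟩ := List.exists_cons_of_ne_nil (List.ne_nil_of_mem hy)
            have h1 := p.isPath
            rw [hw] at h' h1
            exact hr (h'.1.symm.trans h1.1)
        have hl' : l p.head = l (dhead y) := by
          obtain ⟨u, v, huv⟩ := List.append_of_mem hy
          have h1 := p.isPath
          rw [huv, isPath_append] at h1
          obtain ⟨m, h1, h2⟩ := h1
          rw [h1.map_eq hl, h2.1]
        rw [hp, hl', map_smul, hT.trace_wordMatrix]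
      · have h0 : cutSum y p.word = 0 := by
          refine Finset.sum_eq_zero fun k _ => if_neg fun hk => hy ?_
          exact List.mem_of_getElem? hk
        have h1 : T (skewPhi p : Matrix (BlockIdx α) (BlockIdx α) _).trace = 0 := by
          rw [Matrix.trace, map_sum]
          refine Finset.sum_eq_zero fun r _ => ?_
          rw [Matrix.diag_apply, skewPhi_apply]
          split_ifs
          · rw [hT.wordMatrix]
            exact Finset.sum_eq_zero fun k _ => if_neg fun hk => hy (List.mem_of_getElem? hk)
          · exact map_zero T
        rw [h0, map_smul, h1, map_zero, Matrix.zero_apply, smul_zero, smul_zero]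
    · rw [trace_skewPhi_eq_zero p h]
      simp
  exact LinearMap.congr_fun key x

end IsLetterDerivation

theorem block_apply_mk {S : Type*} [AddCommMonoid S] {i j : I}
    (Z : Matrix (Fin (α i)) (Fin (α j)) S) (m : Fin (α i)) (n : Fin (α j)) :
    block i j Z ⟨i, m⟩ ⟨j, n⟩ = Z m n := by
  simp only [block, Matrix.sum_apply, Matrix.single_apply, Sigma.mk.injEq, heq_eq_eq, true_and]
  rw [Finset.sum_eq_single m, Finset.sum_eq_single n]
  · simp
  · intro b _ hb; simp [hb]
  · simp
  · intro b _ hb; simp [hb]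
  · simp

theorem skewLetter_inl_apply (a : Quiver.Total I) (m : Fin (α a.right)) (n : Fin (α a.left)) :
    skewLetter (Sum.inl a) ⟨a.right, m⟩ ⟨a.left, n⟩ =
      coordFun (⟨a, m, n⟩ : Coord α) ⊗ₜ[ℂ] (1 : ExteriorAlgebra ℂ (Rep α)) := by
  rw [skewLetter, letterMatrix, AlgHom.mapMatrix_apply, Matrix.map_apply, block_apply_mk]
  simp [skew]

theorem skewLetter_inr_apply (a : Quiver.Total I) (m : Fin (α a.right)) (n : Fin (α a.left)) :
    skewLetter (Sum.inr a) ⟨a.left, n⟩ ⟨a.right, m⟩ =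
      (1 : PolyFun (Coord α)) ⊗ₜ[ℂ] ExteriorAlgebra.ι ℂ (Pi.single ⟨a, m, n⟩ 1 : Rep α) := by
  rw [skewLetter, letterMatrix, AlgHom.mapMatrix_apply, Matrix.map_apply, block_apply_mk]
  simp [skew]

/-- A property of all entries of the matrices of letters holds if it holds for `0`, for the
coordinate functions and for the coordinate vector fields. -/
theorem skewLetter_cases {motive : DArrow I → BlockIdx α → BlockIdx α → Prop}
    (inl : ∀ (a : Quiver.Total I) (m : Fin (α a.right)) (n : Fin (α a.left)),
      motive (Sum.inl a) ⟨a.right, m⟩ ⟨a.left, n⟩)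
    (inr : ∀ (a : Quiver.Total I) (m : Fin (α a.right)) (n : Fin (α a.left)),
      motive (Sum.inr a) ⟨a.left, n⟩ ⟨a.right, m⟩)
    (off : ∀ (x : DArrow I) (r s : BlockIdx α), ¬(r.1 = dhead x ∧ s.1 = dtail x) → motive x r s)
    (x : DArrow I) (r s : BlockIdx α) : motive x r s := by
  by_cases h : r.1 = dhead x ∧ s.1 = dtail x
  · obtain ⟨i, m⟩ := r
    obtain ⟨j, n⟩ := s
    obtain ⟨rfl, rfl⟩ : i = dhead x ∧ j = dtail x := h
    rcases x with a | a
    · exact inl a m n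
    · exact inr a n m
  · exact off x r s h

theorem isLetterDerivation_coeffDeriv [Fintype (Quiver.Total I)] (a : Quiver.Total I) (m : Fin (α a.right))
    (n : Fin (α a.left)) :
    IsLetterDerivation (Sum.inl a) ⟨a.right, m⟩ ⟨a.left, n⟩
      (coeffDeriv (⟨a, m, n⟩ : Coord α)) where
  mul P s S _ := by
    rw [coeffDeriv_mul, add_comm]
    simp [dualDeg]
  letter := by
    refine skewLetter_cases (fun b m' n' => ?_) (fun b m' n' => ?_) fun x r s h => ?_
    · rw [skewLetter_inl_apply, coeffDeriv, LinearMap.rTensor_tmul]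
      change (MvPolynomial.pderiv _ (MvPolynomial.X _) : MvPolynomial (Coord α) ℂ) ⊗ₜ[ℂ] _ = _
      rw [MvPolynomial.pderiv_X, Pi.single_apply]
      -- Equality of the letters comes first: it identifies the index types of the two matrices
      -- before their entries are compared.
      have e : ((⟨b, m', n'⟩ : Coord α) = ⟨a, m, n⟩) ↔ (Sum.inl b : DArrow I) = Sum.inl a ∧
          (⟨b.right, m'⟩ : BlockIdx α) = ⟨a.right, m⟩ ∧
          (⟨b.left, n'⟩ : BlockIdx α) = ⟨a.left, n⟩ := by
        constructor
        · intro h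
          cases h
          simp
        · rintro ⟨h, h1, h2⟩
          cases h
          simpa using And.intro h1 h2
      rw [if_congr e rfl rfl]
      split_ifs
      · rfl
      · exact TensorProduct.zero_tmul _ _
    · rw [skewLetter_inr_apply, coeffDeriv, LinearMap.rTensor_tmul]
      simp
    · rw [skewLetter_apply_eq_zero x h, map_zero, if_neg]
      rintro ⟨rfl, rfl, rfl⟩
      exact h ⟨rfl, rfl⟩
  row := rfl
  col := rfl

/-- The odd counterpart of `isLetterDerivation_coeffDeriv`. Row and column are exchanged, since
`∂/∂(X_a)ₘₙ` is the `(n, m)` entry of the matrix of `a*`. -/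
theorem isLetterDerivation_contractR (a : Quiver.Total I) (m : Fin (α a.right))
    (n : Fin (α a.left)) :
    IsLetterDerivation (Sum.inr a) ⟨a.left, n⟩ ⟨a.right, m⟩
      (contractR (⟨a, m, n⟩ : Coord α)) where
  mul P s S hS := by
    rw [contractR_mul _ _ hS]
    simp [dualDeg]
  letter := by
    refine skewLetter_cases (fun b m' n' => ?_) (fun b m' n' => ?_) fun x r s h => ?_
    · rw [skewLetter_inl_apply, contractR_tmul,
        ← map_one (algebraMap ℂ (ExteriorAlgebra ℂ (Rep α))), exteriorContractR_algebraMap]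
      simp
    · rw [skewLetter_inr_apply, contractR_tmul, exteriorContractR_ι, LinearMap.proj_apply, Pi.single_apply]
      have e : ((⟨a, m, n⟩ : Coord α) = ⟨b, m', n'⟩) ↔ (Sum.inr b : DArrow I) = Sum.inr a ∧
          (⟨b.left, n'⟩ : BlockIdx α) = ⟨a.left, n⟩ ∧
          (⟨b.right, m'⟩ : BlockIdx α) = ⟨a.right, m⟩ := by
        constructor
        · intro h
          cases h
          simp
        · rintro ⟨h, h1, h2⟩
          cases h
          simpa using And.intro h2.symm h1.symm
      rw [if_congr e rfl rfl]
      split_ifs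
      · rw [map_one]; rfl
      · simp
    · rw [skewLetter_apply_eq_zero x h, map_zero, if_neg]
      rintro ⟨rfl, rfl, rfl⟩
      exact h ⟨rfl, rfl⟩
  row := rfl
  col := rfl

end TwistedDerivation

/-! ### Comparison of the necklace bracket with the Schouten bracket. -/

section BracketComparison

variable {I : Type*} [Quiver I] [DecidableEq I] [DecidableEq (Quiver.Total I)] [Fintype I]
  [Fintype (Quiver.Total I)] {α : I → ℕ}

/-- Removing `y` from a closed path leaves a path with head `t(y)` and tail `h(y)`. -/
theorem pathMatrix_algD_apply_eq_zero (y : DArrow I) (x : PathAlg I) {r s : BlockIdx α}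
    (h : ¬(r.1 = dtail y ∧ s.1 = dhead y)) : pathMatrix α (algD y x) r s = 0 := by
  have key : Matrix.entryLinearMap ℂ _ r s ∘ₗ pathMatrix α ∘ₗ algD y = 0 := by
    refine Finsupp.lhom_ext' fun p => LinearMap.ext_ring ?_
    change pathMatrix α (algD y (Finsupp.single p 1)) r s = 0
    rw [algD_single, pathD]
    split_ifs
    · rw [cutSum, map_sum, Matrix.sum_apply]
      refine Finset.sum_eq_zero fun k _ => ?_
      split_ifs
      · rw [map_smul, Matrix.smul_apply, pathMatrix_ofWord_apply, if_neg h, smul_zero]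
      · simp
    · simp
  exact LinearMap.congr_fun key x

theorem blockDiag_mul_pathMatrix_algD (f : I → ℂ) (y : DArrow I) (x : PathAlg I) :
    blockDiag f * pathMatrix α (algD y x) = f (dtail y) • pathMatrix α (algD y x) := by
  ext r s
  rw [blockDiag, Matrix.diagonal_mul, Matrix.smul_apply, ← Algebra.smul_def]
  by_cases h : r.1 = dtail y
  · rw [h]
  · rw [pathMatrix_algD_apply_eq_zero _ _ fun h' => h h'.1, smul_zero, smul_zero]

/-- Each factor lives in a single block, so the sum over the entries of `X_a` is already the full
trace of the product. -/
theorem sum_sum_pathMatrix_algD (a : Quiver.Total I) (x z : PathAlg I) :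
    ∑ m, ∑ n, pathMatrix α (algD (Sum.inr a) x) ⟨a.right, m⟩ ⟨a.left, n⟩ *
      pathMatrix α (algD (Sum.inl a) z) ⟨a.left, n⟩ ⟨a.right, m⟩ =
    (pathMatrix α (pathMul (algD (Sum.inr a) x) (algD (Sum.inl a) z))).trace := by
  rw [pathMatrix_pathMul, Matrix.trace, Fintype.sum_sigma, Finset.sum_eq_single a.right]
  · refine Finset.sum_congr rfl fun m _ => ?_
    rw [Matrix.diag_apply, Matrix.mul_apply, Fintype.sum_sigma, Finset.sum_eq_single a.left]
    · intro j _ hj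
      refine Finset.sum_eq_zero fun n _ => ?_
      rw [pathMatrix_algD_apply_eq_zero (Sum.inr a) x fun h => hj h.2, zero_mul]
    · simp
  · intro i _ hi
    refine Finset.sum_eq_zero fun m _ => ?_
    rw [Matrix.diag_apply, Matrix.mul_apply]
    refine Finset.sum_eq_zero fun t _ => ?_
    rw [pathMatrix_algD_apply_eq_zero (Sum.inr a) x fun h => hi h.1, zero_mul]
  · simp

/-- The origin of `λ²`: the contraction contributes the weight at `t(a)`, the head of `a*`, and the
derivative the weight at `h(a)`. -/
theorem algPsi_pathMul_algD {l : I → ℂ} (hl : ∀ a : Quiver.Total I, l a.right = l a.left)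
    (a : Quiver.Total I) (x z : PathAlg I) :
    algPsi α (fun i => l i ^ 2) (pathMul (algD (Sum.inr a) x) (algD (Sum.inl a) z)) =
      ∑ m, ∑ n, contractR (⟨a, m, n⟩ : Coord α) (algPsi α l x) *
        coeffDeriv (⟨a, m, n⟩ : Coord α) (algPsi α l z) := by
  simp only [(isLetterDerivation_coeffDeriv a _ _).algPsi hl,
    (isLetterDerivation_contractR a _ _).algPsi hl, smul_mul_smul_comm, ← Finset.smul_sum]
  rw [sum_sum_pathMatrix_algD, algPsi_eq_trace, pathMatrix_pathMul, ← mul_assoc,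
    blockDiag_mul_pathMatrix_algD, smul_mul_assoc, Matrix.trace_smul]
  congr 1
  change l a.right ^ 2 = l a.left * l a.right
  rw [hl a, sq]

theorem schouten_algPsi {l : I → ℂ} (hl : ∀ a : Quiver.Total I, l a.right = l a.left)
    (p q : DPath I) :
    schouten (algPsi α l (Finsupp.single p 1)) (algPsi α l (Finsupp.single q 1)) =
      Psi α (fun i => l i ^ 2) (fun a => congrArg (· ^ 2) (hl a)) (pathBracket p q) := by
  have hPsi : ∀ x : PathAlg I, Psi α (fun i => l i ^ 2) (fun a => congrArg (· ^ 2) (hl a))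
      (toNecklace x) = algPsi α (fun i => l i ^ 2) x := fun x => rfl
  have hp := algPsi_mem_polyGrade (α := α) l (single_mem_pathGrade p)
  have hq := algPsi_mem_polyGrade (α := α) l (single_mem_pathGrade q)
  rw [schouten_apply, Fintype.sum_sigma, pathBracket, map_sum]
  refine Finset.sum_congr rfl fun a _ => ?_
  simp only [map_sub, map_smul, hPsi, ← algD_single, algPsi_pathMul_algD hl,
    Fintype.sum_prod_type, Finset.smul_sum, coeffDeriv_mul_contractL _ hp hq,
    Finset.sum_sub_distrib]

theorem Psi_necklaceBracket {l : I → ℂ} (hl : ∀ a : Quiver.Total I, l a.right = l a.left)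
    (γ δ : NecklaceSpace I) :
    Psi α (fun i => l i ^ 2) (fun a => congrArg (· ^ 2) (hl a)) (necklaceBracket γ δ) =
      schouten (Psi α l hl γ) (Psi α l hl δ) := by
  -- Both sides are bilinear, so after passing to representatives in the path algebra it suffices to
  -- compare them on pairs of paths.
  have key : (algBracket (I := I)).compr₂
      (Psi α (fun i => l i ^ 2) (fun a => congrArg (· ^ 2) (hl a))) =
      (schouten (ι := Coord α)).compl₁₂ (algPsi α l) (algPsi α l) := by
    refine Finsupp.lhom_ext' fun p => LinearMap.ext_ring (Finsupp.lhom_ext' fun q =>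
      LinearMap.ext_ring ?_)
    simpa [algBracket] using (schouten_algPsi hl p q).symm
  obtain ⟨x, rfl⟩ := (superCommutators I).mkQ_surjective γ
  obtain ⟨z, rfl⟩ := (superCommutators I).mkQ_surjective δ
  exact LinearMap.congr_fun₂ key x z

theorem Psi_mem_polyGrade (l : I → ℂ) (hl : ∀ a : Quiver.Total I, l a.right = l a.left) {r : ℕ}
    {γ : NecklaceSpace I} (hγ : γ ∈ necklaceGrade I r) :
    Psi α l hl γ ∈ polyGrade (Coord α) r := by
  obtain ⟨x, hx, rfl⟩ := hγ
  exact algPsi_mem_polyGrade l hx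

end BracketComparison

/-! ### Invariance under the group. -/

section Invariance

variable {I : Type*} [Quiver I] [DecidableEq I] [DecidableEq (Quiver.Total I)] [Fintype I]
  [Fintype (Quiver.Total I)] {α : I → ℕ}

/-- Evaluation of polyvector fields at a point, as a homomorphism of algebras. -/
def evalAtHom {ι : Type*} (X : ι → ℂ) : PolyVector ι →ₐ[ℂ] ExteriorAlgebra ℂ (ι → ℂ) :=
  (Algebra.TensorProduct.lid ℂ (ExteriorAlgebra ℂ (ι → ℂ))).toAlgHom.comp
    (Algebra.TensorProduct.map (evalFun X) (AlgHom.id ℂ _))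

theorem evalAt_eq_evalAtHom {ι : Type*} (X : ι → ℂ) (P : PolyVector ι) :
    evalAt X P = evalAtHom X P :=
  rfl

theorem evalAtHom_tmul {ι : Type*} (X : ι → ℂ) (f : PolyFun ι)
    (x : ExteriorAlgebra ℂ (ι → ℂ)) : evalAtHom X (f ⊗ₜ[ℂ] x) = evalFun X f • x :=
  rfl

/-- The block diagonal matrix with scalar blocks `g i`. -/
def scalarBlocks (A : Type*) [Semiring A] [Algebra ℂ A] (g : ∀ i, Matrix (Fin (α i)) (Fin (α i)) ℂ) :
    Matrix (BlockIdx α) (BlockIdx α) A :=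
  (Matrix.blockDiagonal' g).map (algebraMap ℂ A)

variable {A : Type*} [Ring A] [Algebra ℂ A]

theorem scalarBlocks_mul (g h : ∀ i, Matrix (Fin (α i)) (Fin (α i)) ℂ) :
    scalarBlocks A g * scalarBlocks A h = scalarBlocks A fun i => g i * h i := by
  rw [scalarBlocks, scalarBlocks, scalarBlocks, ← Matrix.map_mul, Matrix.blockDiagonal'_mul]

theorem scalarBlocks_one : scalarBlocks A (fun i => (1 : Matrix (Fin (α i)) (Fin (α i)) ℂ)) = 1 := by
  rw [scalarBlocks, show (fun i => (1 : Matrix (Fin (α i)) (Fin (α i)) ℂ)) = 1 from rfl,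
    Matrix.blockDiagonal'_one, Matrix.map_one _ (map_zero _) (map_one _)]

theorem scalarBlocks_mul_apply (g : ∀ i, Matrix (Fin (α i)) (Fin (α i)) ℂ)
    (Z : Matrix (BlockIdx α) (BlockIdx α) A) (i : I) (m : Fin (α i)) (s : BlockIdx α) :
    (scalarBlocks A g * Z) ⟨i, m⟩ s = ∑ m', g i m m' • Z ⟨i, m'⟩ s := by
  rw [Matrix.mul_apply, Fintype.sum_sigma, Finset.sum_eq_single i]
  · refine Finset.sum_congr rfl fun m' _ => ?_
    rw [scalarBlocks, Matrix.map_apply, Matrix.blockDiagonal'_apply_eq, Algebra.smul_def]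
  · intro j _ hj
    refine Finset.sum_eq_zero fun m' _ => ?_
    rw [scalarBlocks, Matrix.map_apply, Matrix.blockDiagonal'_apply_ne _ _ _ hj.symm, map_zero,
      zero_mul]
  · simp

theorem mul_scalarBlocks_apply (g : ∀ i, Matrix (Fin (α i)) (Fin (α i)) ℂ)
    (Z : Matrix (BlockIdx α) (BlockIdx α) A) (i : I) (m : Fin (α i)) (r : BlockIdx α) :
    (Z * scalarBlocks A g) r ⟨i, m⟩ = ∑ m', g i m' m • Z r ⟨i, m'⟩ := by
  rw [Matrix.mul_apply, Fintype.sum_sigma, Finset.sum_eq_single i]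
  · refine Finset.sum_congr rfl fun m' _ => ?_
    rw [scalarBlocks, Matrix.map_apply, Matrix.blockDiagonal'_apply_eq, Algebra.smul_def,
      Algebra.commutes]
  · intro j _ hj
    refine Finset.sum_eq_zero fun m' _ => ?_
    rw [scalarBlocks, Matrix.map_apply, Matrix.blockDiagonal'_apply_ne _ _ _ hj, map_zero,
      mul_zero]
  · simp

/-- The trace is not cyclic over a noncommutative ring, but scalar entries are central. -/
theorem trace_scalarBlocks_mul (g : ∀ i, Matrix (Fin (α i)) (Fin (α i)) ℂ)
    (Z : Matrix (BlockIdx α) (BlockIdx α) A) :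
    (scalarBlocks A g * Z).trace = (Z * scalarBlocks A g).trace := by
  simp only [Matrix.trace, Matrix.diag_apply, Matrix.mul_apply]
  rw [Finset.sum_comm]
  refine Finset.sum_congr rfl fun r _ => Finset.sum_congr rfl fun s _ => ?_
  rw [scalarBlocks, Matrix.map_apply, Algebra.commutes]

theorem scalarBlocks_smul_one (f : I → ℂ) :
    scalarBlocks (PolyVector (Coord α)) (fun i => f i • 1) = blockDiag f := by
  ext ⟨i, m⟩ ⟨j, n⟩
  rw [scalarBlocks, Matrix.map_apply, blockDiag, Matrix.blockDiagonal'_apply', Matrix.diagonal_apply]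
  by_cases h : i = j
  · subst h
    by_cases h' : m = n <;> simp [h']
  · simp [h]

theorem mapMatrix_scalarBlocks {B : Type*} [Ring B] [Algebra ℂ B] (F : A →ₐ[ℂ] B)
    (g : ∀ i, Matrix (Fin (α i)) (Fin (α i)) ℂ) :
    F.mapMatrix (scalarBlocks A g) = scalarBlocks B g := by
  ext r s
  simp [scalarBlocks]

/-- The argument of `repAct` is the expansion of `g_{h(a)}⁻¹ E_{mn} g_{t(a)}` in matrix units, which
the action maps back to `E_{mn}`. Read in the entries of the matrix of `a*`, this is conjugation by
`g`. -/
theorem single_eq_repAct_sum (g : ∀ i, GL (Fin (α i)) ℂ) (a : Quiver.Total I)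
    (m : Fin (α a.right)) (n : Fin (α a.left)) :
    (Pi.single ⟨a, m, n⟩ 1 : Rep α) = repAct g (∑ m', (g a.right)⁻¹.val m' m •
      ∑ n', (g a.left).val n n' • Pi.single ⟨a, m', n'⟩ 1) := by
  ext ⟨b, i, j⟩
  set Z : Rep α := ∑ m', (g a.right)⁻¹.val m' m •
      ∑ n', (g a.left).val n n' • Pi.single ⟨a, m', n'⟩ 1 with hZ
  change _ = ((g b.right).val * repMatrix Z b * (g b.left)⁻¹.val) i j
  by_cases h : b = a
  · subst h
    have e : repMatrix Z b = (g b.right)⁻¹.val * Matrix.single m n (1 : ℂ) * (g b.left).val := by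
      ext u v
      rw [Matrix.mul_assoc, Matrix.mul_apply, repMatrix, Matrix.of_apply, hZ]
      simp only [Finset.sum_apply, Pi.smul_apply, Pi.single_apply, smul_eq_mul, Matrix.mul_apply,
        Matrix.single_apply, Sigma.mk.injEq, heq_eq_eq, true_and, Prod.mk.injEq]
      rw [Finset.sum_eq_single u, Finset.sum_eq_single m, Finset.sum_eq_single v,
        Finset.sum_eq_single n]
      · simp
      · intro k _ hk; simp [hk.symm]
      · simp
      · intro k _ hk; simp [hk.symm]
      · simp
      · intro k _ hk; simp [hk.symm]
      · simp
      · intro k _ hk; simp [hk.symm]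
      · simp
    rw [e, Matrix.mul_assoc (g b.right)⁻¹.val, ← Matrix.mul_assoc (g b.right).val, Units.mul_inv,
      Matrix.one_mul, Matrix.mul_assoc, Units.mul_inv, Matrix.mul_one, Matrix.single_apply,
      Pi.single_apply]
    simp [eq_comm]
  · have e : repMatrix Z b = 0 := by
      ext u v
      simp [repMatrix, hZ, Finset.sum_apply, h]
    rw [e, Matrix.mul_zero, Matrix.zero_mul, Pi.single_eq_of_ne, Matrix.zero_apply]
    exact fun h' => h (congrArg Sigma.fst h')

/-- The value of the matrix of a letter at `g X` is conjugate to the push-forward of its value at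
`X`. -/
theorem evalAtHom_repAct_skewLetter (g : ∀ i, GL (Fin (α i)) ℂ) (X : Rep α) (x : DArrow I) :
    (evalAtHom (repAct g X)).mapMatrix (skewLetter x) =
      scalarBlocks _ (fun i => (g i).val) *
        ((ExteriorAlgebra.map (repAct g)).comp (evalAtHom X)).mapMatrix (skewLetter x) *
        scalarBlocks _ (fun i => (g i)⁻¹.val) := by
  ext r s
  revert x r s
  refine skewLetter_cases (fun a m n => ?_) (fun a m n => ?_) fun x r s h => ?_
  -- For coordinate functions the push-forward fixes the scalar values, and the claim is the
  -- definition of the action.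
  · rw [mul_scalarBlocks_apply]
    simp only [scalarBlocks_mul_apply, AlgHom.mapMatrix_apply, Matrix.map_apply, AlgHom.comp_apply,
      skewLetter_inl_apply, evalAtHom_tmul]
    have e : ∀ (Z : Rep α) c, evalFun Z (coordFun c) = Z c := fun Z c => MvPolynomial.aeval_X Z c
    simp only [e, map_smul, map_one, smul_smul, Finset.smul_sum]
    simp only [← Finset.sum_smul]
    congr 1
    change ((g a.right).val * repMatrix X a * (g a.left)⁻¹.val) m n = _
    rw [Matrix.mul_apply]
    refine Finset.sum_congr rfl fun n' _ => ?_
    rw [Matrix.mul_apply, Finset.sum_mul]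
    refine Finset.sum_congr rfl fun m' _ => ?_
    rw [mul_comm]
    rfl
  -- The coordinate vector fields are constant, so the base point plays no role and only the
  -- push-forward of tangent vectors matters.
  · rw [mul_scalarBlocks_apply]
    simp only [scalarBlocks_mul_apply, AlgHom.mapMatrix_apply, Matrix.map_apply, AlgHom.comp_apply,
      skewLetter_inr_apply, evalAtHom_tmul, map_one, one_smul, ExteriorAlgebra.map_apply_ι,
      ← map_smul, ← map_sum]
    congr 1
    exact single_eq_repAct_sum g a m n
  · rw [AlgHom.mapMatrix_apply, Matrix.map_apply, skewLetter_apply_eq_zero x h, map_zero]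
    obtain ⟨i, m⟩ := r
    obtain ⟨j, n⟩ := s
    rw [mul_scalarBlocks_apply]
    refine (Finset.sum_eq_zero fun n' _ => ?_).symm
    rw [scalarBlocks_mul_apply, Finset.sum_eq_zero, smul_zero]
    intro m' _
    rw [AlgHom.mapMatrix_apply, Matrix.map_apply, skewLetter_apply_eq_zero (r := ⟨i, m'⟩) (c := ⟨j, n'⟩) x h,
      map_zero, smul_zero]

theorem evalAtHom_repAct_wordMatrix (g : ∀ i, GL (Fin (α i)) ℂ) (X : Rep α)
    (w : List (DArrow I)) :
    (evalAtHom (repAct g X)).mapMatrix (wordMatrix α w) =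
      scalarBlocks _ (fun i => (g i).val) *
        ((ExteriorAlgebra.map (repAct g)).comp (evalAtHom X)).mapMatrix (wordMatrix α w) *
        scalarBlocks _ (fun i => (g i)⁻¹.val) := by
  induction w with
  | nil =>
    have h : scalarBlocks (ExteriorAlgebra ℂ (Rep α)) (fun i => (g i).val) *
        scalarBlocks _ (fun i => (g i)⁻¹.val) = 1 := by
      simp only [scalarBlocks_mul, Units.mul_inv, scalarBlocks_one]
    rw [wordMatrix, List.map_nil, List.prod_nil, map_one, map_one, mul_one, h]
  | cons x w ih =>
    have h : scalarBlocks (ExteriorAlgebra ℂ (Rep α)) (fun i => (g i)⁻¹.val) *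
        scalarBlocks _ (fun i => (g i).val) = 1 := by
      simp only [scalarBlocks_mul, Units.inv_mul, scalarBlocks_one]
    rw [wordMatrix_cons, map_mul, map_mul, ih, evalAtHom_repAct_skewLetter]
    simp only [mul_assoc]
    rw [← mul_assoc (scalarBlocks _ _) (scalarBlocks _ _), h, one_mul]

theorem isInvariant_trace_skewPhi (p : DPath I) :
    IsInvariant (skewPhi p : Matrix (BlockIdx α) (BlockIdx α) _).trace := by
  intro g X
  rw [evalAt_eq_evalAtHom, evalAt_eq_evalAtHom, ← AlgHom.comp_apply, AddMonoidHom.map_trace,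
    AddMonoidHom.map_trace]
  change ((evalAtHom (repAct g X)).mapMatrix (skewPhi p)).trace =
    (((ExteriorAlgebra.map (repAct g)).comp (evalAtHom X)).mapMatrix (skewPhi p)).trace
  -- The idempotent at the head has scalar blocks. Once `g⁻¹` has been cycled to the front, it
  -- commutes with `g`, and `g⁻¹ g` cancels.
  rw [skewPhi_eq_wordMatrix, map_mul, map_mul, evalAtHom_repAct_wordMatrix,
    ← scalarBlocks_smul_one, mapMatrix_scalarBlocks, mapMatrix_scalarBlocks, ← mul_assoc,
    ← trace_scalarBlocks_mul, ← mul_assoc, ← mul_assoc, scalarBlocks_mul, scalarBlocks_mul]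
  simp

theorem isInvariant_Psi (l : I → ℂ) (hl : ∀ a : Quiver.Total I, l a.right = l a.left)
    (γ : NecklaceSpace I) : IsInvariant (Psi α l hl γ) := by
  intro g X
  have key : evalAt (repAct g X) ∘ₗ algPsi α l =
      (ExteriorAlgebra.map (repAct g)).toLinearMap ∘ₗ evalAt X ∘ₗ algPsi α l := by
    refine Finsupp.lhom_ext' fun p => LinearMap.ext_ring ?_
    change evalAt (repAct g X) (algPsi α l (Finsupp.single p 1)) =
      ExteriorAlgebra.map (repAct g) (evalAt X (algPsi α l (Finsupp.single p 1)))
    rw [algPsi_single, map_smul, map_smul, map_smul, isInvariant_trace_skewPhi p g X]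
  obtain ⟨x, rfl⟩ := (superCommutators I).mkQ_surjective γ
  exact LinearMap.congr_fun key x

end Invariance

end Necklace

end

theorem mainTheorem1 {I : Type*} [Fintype I] [DecidableEq I] [Quiver I]
    [Fintype (Quiver.Total I)] [DecidableEq (Quiver.Total I)] (α : I → ℕ) :
    -- the map `Ψ_λ` takes values in `G`-invariant polyvector fields and preserves degrees
    (∀ (l : I → ℂ) (hl : ∀ a : Quiver.Total I, l a.right = l a.left),
      (∀ γ : Necklace.NecklaceSpace I, Necklace.IsInvariant (Necklace.Psi α l hl γ)) ∧
      (∀ (r : ℕ), ∀ γ ∈ Necklace.necklaceGrade I r,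
        Necklace.Psi α l hl γ ∈ Necklace.polyGrade (Necklace.Coord α) r)) ∧
    -- the map `Ψ` given by the usual trace commutes with the Schouten brackets
    (∀ γ δ : Necklace.NecklaceSpace I,
      Necklace.Psi α (fun _ => 1) (fun _ => rfl) (Necklace.necklaceBracket γ δ) =
        Necklace.schouten (Necklace.Psi α (fun _ => 1) (fun _ => rfl) γ)
          (Necklace.Psi α (fun _ => 1) (fun _ => rfl) δ)) ∧
    -- the general case: the bracket of two values of `Ψ_λ` is computed by `Ψ` with weights `λᵢ²`
    (∀ (l : I → ℂ) (hl : ∀ a : Quiver.Total I, l a.right = l a.left)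
        (γ δ : Necklace.NecklaceSpace I),
      Necklace.Psi α (fun i => l i ^ 2) (fun a => congrArg (· ^ 2) (hl a))
          (Necklace.necklaceBracket γ δ) =
        Necklace.schouten (Necklace.Psi α l hl γ) (Necklace.Psi α l hl δ)) ∧
    -- Poisson structures on `ℂQ` induce `G`-invariant Poisson structures on `Rep(Q, α)`
    (∀ (l : I → ℂ) (hl : ∀ a : Quiver.Total I, l a.right = l a.left)
        (Pi : Necklace.NecklaceSpace I), Necklace.IsNecklacePoisson Pi →
      Necklace.IsPoisson (Necklace.Psi α l hl Pi) ∧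
        Necklace.IsInvariant (Necklace.Psi α l hl Pi)) := by
  have hinv := fun l hl γ => Necklace.isInvariant_Psi (α := α) l hl γ
  have hdeg := fun l hl (r : ℕ) γ (hγ : γ ∈ Necklace.necklaceGrade I r) =>
    Necklace.Psi_mem_polyGrade (α := α) l hl hγ
  refine ⟨fun l hl => ⟨hinv l hl, hdeg l hl⟩, fun γ δ => ?_,
    fun l hl γ δ => Necklace.Psi_necklaceBracket hl γ δ,
    fun l hl Pi hPi => ⟨⟨hdeg l hl 2 Pi hPi.1, ?_⟩, hinv l hl Pi⟩⟩
  · rw [← Necklace.Psi_necklaceBracket]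
    -- The constant weight `1` equals its square, so the general formula specialises.
    simp only [one_pow]
  · rw [← Necklace.Psi_necklaceBracket, hPi.2, map_zero]
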